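/- **Theorem 6.1 (the soft cylinder is semiprojective).** Let $\varepsilon>0$. Consider pairs $(u,h)$ of elements of unital C*-algebras that satisfy the relations $$u^*u=uu^*=1,\qquad -1\le h\le 1,\qquad \|uh-hu\|\le\varepsilon .$$ The *soft cylinder* $A_\varepsilon$ is the universal unital C*-algebra for these relations, i.e. the Hausdorff completion of the free unital complex $*$-algebra on $u,h$ with respect to the seminorm $\|p\|_\varepsilon=\sup\|p(v,k)\|$, where $(v,k)$ runs over all pairs of elements of unital C*-algebras that satisfy the relations. (Equivalently, $A_\varepsilon$ is a unital C*-algebra with elements $u,h$ satisfying the relations such that, for every unital C*-algebra $B$ and all $v,k\in B$ satisfying them, there is exactly one unital $*$-homomorphism $A_\varepsilon\to B$ with $u\mapsto v$, $h\mapsto k$.) Then $A_\varepsilon$ is *semiprojective*: it is separable and, for every (not necessarily unital) C*-algebra $B$, every increasing sequence $J_0\subseteq J_1\subseteq\cdots$ of closed two-sided ideals of $B$ with $K=\overline{\bigcup_n J_n}$, and every (not necessarily unital) $*$-homomorphism $\varphi\colon A_\varepsilon\to B/K$, there are $n$ and a $*$-homomorphism $\psi\colon A_\varepsilon\to B/J_n$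 with $\pi_n\circ\psi=\varphi$, where $\pi_n\colon B/J_n\to B/K$ is the canonical map. -/

import Mathlib

set_option linter.unusedSectionVars false

universe v

noncomputable section

/-! ## Closed ideals and quotient C*-algebras -/

/-- A closed two-sided ideal of a (not necessarily unital) C*-algebra. -/
structure ClosedIdeal (B : Type*) [NonUnitalCStarAlgebra B] extends Submodule ℂ B where
  mul_mem_left' : ∀ (b : B) {x : B}, x ∈ carrier → b * x ∈ carrier
  mul_mem_right' : ∀ (b : B) {x : B}, x ∈ carrier → x * b ∈ carrier
  isClosed' : IsClosed carrier

namespace ClosedIdeal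

variable {B : Type*} [NonUnitalCStarAlgebra B]

instance : SetLike (ClosedIdeal B) B where
  coe I := I.carrier
  coe_injective I J h := by
    obtain ⟨I, _, _, _⟩ := I
    obtain ⟨J, _, _, _⟩ := J
    congr
    exact SetLike.coe_injective h

/-- Ideals are ordered by inclusion. -/
instance : PartialOrder (ClosedIdeal B) := PartialOrder.ofSetLike (ClosedIdeal B) B

variable (I : ClosedIdeal B)

theorem isClosed : IsClosed (I : Set B) := I.isClosed'

instance : IsClosed (I.toSubmodule : Set B) := I.isClosed'

theorem mul_left (b : B) {x : B} (hx : x ∈ I) : b * x ∈ I := I.mul_mem_left' b hx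

theorem mul_right (b : B) {x : B} (hx : x ∈ I) : x * b ∈ I := I.mul_mem_right' b hx

/-- Multiplication by `1 - e` on the right is a contraction, for a positive contraction `e`. -/
theorem norm_sub_mul_le [PartialOrder B] [StarOrderedRing B] {e : B} (he : 0 ≤ e)
    (he1 : ‖e‖ ≤ 1) (x : B) : ‖x - x * e‖ ≤ ‖x‖ := by
  have h1 : ‖star x - e * star x‖ ≤ ‖star x‖ := by
    refine CStarAlgebra.norm_sub_mul_self_le_of_inr (star x) le_rfl he he1 (norm_nonneg _) ?_
    rw [Unitization.inr_zero, sub_zero, mul_one, CStarRing.norm_star_mul_self,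
      Unitization.norm_inr, sq]
  rw [← norm_star x, ← norm_star (x - x * e)]
  simpa [(IsSelfAdjoint.of_nonneg he).star_eq] using h1

/-- Approximate units of closed *-subalgebras. -/
theorem exists_approx (S : NonUnitalStarSubalgebra ℂ B) (hS : IsClosed (S : Set B)) {j : B}
    (hj : j ∈ S) {δ : ℝ} (hδ : 0 < δ) :
    ∃ e ∈ S, star e = e ∧ (∀ x : B, ‖x - x * e‖ ≤ ‖x‖) ∧ ‖j - j * e‖ < δ := by
  let _ := CStarAlgebra.spectralOrder B
  let _ := CStarAlgebra.spectralOrderedRing B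
  have : IsClosed (S : Set B) := hS
  let _ : NonUnitalCStarAlgebra S := NonUnitalStarSubalgebra.nonUnitalCStarAlgebra S
  let _ := CStarAlgebra.spectralOrder S
  let _ := CStarAlgebra.spectralOrderedRing S
  have hu := CStarAlgebra.increasingApproximateUnit S
  have ht := hu.tendsto_mul_left ⟨j, hj⟩
  have hev := (Metric.tendsto_nhds.1 ht δ hδ).and (hu.eventually_nonneg.and hu.eventually_norm)
  obtain ⟨e, he, he0, he1⟩ := hev.exists
  have hpos : (0 : B) ≤ (e : B) := by
    obtain ⟨s, hs⟩ := CStarAlgebra.nonneg_iff_eq_star_mul_self.1 he0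
    rw [hs]
    exact star_mul_self_nonneg (s : B)
  refine ⟨e, e.2, (IsSelfAdjoint.of_nonneg hpos).star_eq, norm_sub_mul_le hpos he1, ?_⟩
  rw [dist_comm, dist_eq_norm] at he
  exact he

/-- Closed ideals are self-adjoint. -/
theorem star_mem {x : B} (hx : x ∈ I) : star x ∈ I := by
  let S : NonUnitalStarSubalgebra ℂ B :=
    { carrier := {y | y ∈ I ∧ star y ∈ I}
      add_mem' := fun {a b} ha hb =>
        ⟨I.add_mem ha.1 hb.1, by rw [star_add]; exact I.add_mem ha.2 hb.2⟩
      zero_mem' := ⟨I.zero_mem, by rw [star_zero]; exact I.zero_mem⟩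
      mul_mem' := fun {a b} ha hb => ⟨I.mul_left _ hb.1, by rw [star_mul]; exact I.mul_left _ ha.2⟩
      smul_mem' := fun c a ha =>
        ⟨I.smul_mem c ha.1, by rw [star_smul]; exact I.smul_mem _ ha.2⟩
      star_mem' := fun {a} ha => ⟨ha.2, by rw [star_star]; exact ha.1⟩ }
  have hS : IsClosed (S : Set B) := I.isClosed.inter (I.isClosed.preimage continuous_star)
  have hxx : x * star x ∈ S :=
    ⟨I.mul_right _ hx, by rw [star_mul, star_star]; exact I.mul_right _ hx⟩
  refine I.isClosed.closure_subset (Metric.mem_closure_iff.2 fun δ hδ => ?_)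
  obtain ⟨e, heS, hse, hc, hlt⟩ := exists_approx S hS hxx (δ := δ ^ 2) (by positivity)
  refine ⟨star x * e, I.mul_left _ heS.1, ?_⟩
  rw [dist_eq_norm]
  have key : star (star x - star x * e) * (star x - star x * e)
      = star ((star ((x * star x) - (x * star x) * e)) - (star ((x * star x) - (x * star x) * e)) * e) := by
    simp only [star_sub, star_mul, star_star, hse, mul_sub, sub_mul, mul_assoc]
    abel
  have h2 : ‖star x - star x * e‖ ^ 2 < δ ^ 2 := by
    rw [sq, ← CStarRing.norm_star_mul_self, key, norm_star]
    refine (hc _).trans_lt ?_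
    rwa [norm_star]
  exact lt_of_pow_lt_pow_left₀ 2 hδ.le h2

/-- A closed ideal as a *-subalgebra. -/
def toStarSubalgebra : NonUnitalStarSubalgebra ℂ B where
  carrier := I
  add_mem' := I.add_mem'
  zero_mem' := I.zero_mem'
  smul_mem' := I.smul_mem'
  mul_mem' := fun {a _} _ hb => I.mul_left a hb
  star_mem' := fun h => I.star_mem h

/-- The quotient `B / I`, with the quotient norm. -/
def Quotient : Type _ := B ⧸ I.toSubmodule

namespace Quotient

instance : NormedAddCommGroup I.Quotient :=
  inferInstanceAs (NormedAddCommGroup (B ⧸ I.toSubmodule))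

instance : Module ℂ I.Quotient := inferInstanceAs (Module ℂ (B ⧸ I.toSubmodule))

instance : NormedSpace ℂ I.Quotient := inferInstanceAs (NormedSpace ℂ (B ⧸ I.toSubmodule))

instance : CompleteSpace I.Quotient := inferInstanceAs (CompleteSpace (B ⧸ I.toSubmodule))

variable {I}

/-- The class of an element of `B`. -/
def proj : B →ₗ[ℂ] I.Quotient := I.toSubmodule.mkQ

theorem proj_surjective : Function.Surjective (proj : B → I.Quotient) :=
  I.toSubmodule.mkQ_surjective

theorem proj_eq {a b : B} : (proj a : I.Quotient) = proj b ↔ a - b ∈ I :=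
  Submodule.Quotient.eq I.toSubmodule

theorem norm_proj_le (a : B) : ‖(proj a : I.Quotient)‖ ≤ ‖a‖ :=
  Submodule.Quotient.norm_mk_le I.toSubmodule a

theorem exists_norm_lt (x : I.Quotient) {δ : ℝ} (hδ : 0 < δ) :
    ∃ a : B, proj a = x ∧ ‖a‖ < ‖x‖ + δ :=
  Submodule.Quotient.norm_mk_lt (S := I.toSubmodule) x hδ

/-- The product with `proj a * proj b = proj (a * b)`. -/
instance : Mul I.Quotient where
  mul := Quotient.map₂ (· * ·) (by
    intro a a' ha b b' hb
    have ha' : a - a' ∈ I := (Submodule.quotientRel_def I.toSubmodule).1 ha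
    have hb' : b - b' ∈ I := (Submodule.quotientRel_def I.toSubmodule).1 hb
    refine (Submodule.quotientRel_def I.toSubmodule).2 ?_
    have : a * b - a' * b' = (a - a') * b + a' * (b - b') := by noncomm_ring
    rw [this]
    exact I.add_mem (I.mul_right _ ha') (I.mul_left _ hb'))

/-- The involution with `star (proj a) = proj (star a)`. -/
instance : Star I.Quotient where
  star := Quotient.map star (by
    intro a a' ha
    have ha' : a - a' ∈ I := (Submodule.quotientRel_def I.toSubmodule).1 ha
    refine (Submodule.quotientRel_def I.toSubmodule).2 ?_
    rw [← star_sub]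
    exact I.star_mem ha')

theorem proj_mul (a b : B) : (proj (a * b) : I.Quotient) = proj a * proj b := rfl

theorem proj_star (a : B) : (proj (star a) : I.Quotient) = star (proj a) := rfl

instance : NonUnitalRing I.Quotient :=
  { (inferInstance : AddCommGroup I.Quotient), (inferInstance : Mul I.Quotient) with
    left_distrib := fun x y z => by
      obtain ⟨a, rfl⟩ := proj_surjective x
      obtain ⟨b, rfl⟩ := proj_surjective y
      obtain ⟨c, rfl⟩ := proj_surjective z
      simp only [← map_add, ← proj_mul, mul_add]
    right_distrib := fun x y z => by
      obtain ⟨a, rfl⟩ := proj_surjective x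
      obtain ⟨b, rfl⟩ := proj_surjective y
      obtain ⟨c, rfl⟩ := proj_surjective z
      simp only [← map_add, ← proj_mul, add_mul]
    zero_mul := fun x => by
      obtain ⟨a, rfl⟩ := proj_surjective x
      rw [← map_zero (proj : B →ₗ[ℂ] I.Quotient), ← proj_mul, zero_mul]
    mul_zero := fun x => by
      obtain ⟨a, rfl⟩ := proj_surjective x
      rw [← map_zero (proj : B →ₗ[ℂ] I.Quotient), ← proj_mul, mul_zero]
    mul_assoc := fun x y z => by
      obtain ⟨a, rfl⟩ := proj_surjective x
      obtain ⟨b, rfl⟩ := proj_surjective y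
      obtain ⟨c, rfl⟩ := proj_surjective z
      simp only [← proj_mul, mul_assoc] }

instance : StarRing I.Quotient where
  star_involutive := fun x => by
    obtain ⟨a, rfl⟩ := proj_surjective x
    rw [← proj_star, ← proj_star, star_star]
  star_mul := fun x y => by
    obtain ⟨a, rfl⟩ := proj_surjective x
    obtain ⟨b, rfl⟩ := proj_surjective y
    simp only [← proj_mul, ← proj_star, star_mul]
  star_add := fun x y => by
    obtain ⟨a, rfl⟩ := proj_surjective x
    obtain ⟨b, rfl⟩ := proj_surjective y
    simp only [← map_add, ← proj_star, star_add]

instance : NonUnitalNormedRing I.Quotient :=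
  { (inferInstance : NormedAddCommGroup I.Quotient),
    (inferInstance : NonUnitalRing I.Quotient) with
    norm_mul_le := fun x y => by
      have hlim : Filter.Tendsto (fun δ : ℝ => (‖x‖ + δ) * (‖y‖ + δ)) (nhdsWithin 0 (Set.Ioi 0))
          (nhds (‖x‖ * ‖y‖)) := by
        have : Continuous fun δ : ℝ => (‖x‖ + δ) * (‖y‖ + δ) := by fun_prop
        simpa using (this.tendsto 0).mono_left nhdsWithin_le_nhds
      refine ge_of_tendsto hlim (eventually_nhdsWithin_of_forall fun δ (hδ : 0 < δ) => ?_)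
      obtain ⟨a, rfl, ha⟩ := exists_norm_lt x hδ
      obtain ⟨b, rfl, hb⟩ := exists_norm_lt y hδ
      rw [← proj_mul]
      exact (norm_proj_le _).trans ((norm_mul_le a b).trans
        (mul_le_mul ha.le hb.le (norm_nonneg _) (by positivity))) }

instance : IsScalarTower ℂ I.Quotient I.Quotient where
  smul_assoc c x y := by
    obtain ⟨a, rfl⟩ := proj_surjective x
    obtain ⟨b, rfl⟩ := proj_surjective y
    simp only [smul_eq_mul, ← map_smul, ← proj_mul, smul_mul_assoc]

instance : SMulCommClass ℂ I.Quotient I.Quotient where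
  smul_comm c x y := by
    obtain ⟨a, rfl⟩ := proj_surjective x
    obtain ⟨b, rfl⟩ := proj_surjective y
    simp only [smul_eq_mul, ← map_smul, ← proj_mul, mul_smul_comm]

instance : StarModule ℂ I.Quotient where
  star_smul c x := by
    obtain ⟨a, rfl⟩ := proj_surjective x
    simp only [← map_smul, ← proj_star, star_smul]

instance : CStarRing I.Quotient where
  norm_mul_self_le := fun x => by
    obtain ⟨a, rfl⟩ := proj_surjective x
    rw [← proj_star, ← proj_mul]
    refine le_of_forall_pos_le_add fun δ hδ => ?_
    obtain ⟨c, hc, hcn⟩ := exists_norm_lt (proj (star a * a) : I.Quotient) (half_pos hδ)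
    have hj : star a * a - c ∈ I.toStarSubalgebra := proj_eq.1 hc.symm
    obtain ⟨e, heI, hse, hcontr, hlt⟩ :=
      exists_approx I.toStarSubalgebra I.isClosed hj (half_pos hδ)
    have h1 : (proj a : I.Quotient) = proj (a - a * e) := by
      rw [proj_eq, sub_sub_cancel]
      exact I.mul_left a heI
    have hcl (y : B) : ‖y - e * y‖ ≤ ‖y‖ := by
      rw [← norm_star y, ← norm_star (y - e * y)]
      simpa [hse] using hcontr (star y)
    have h2 : star (a - a * e) * (a - a * e) = (c - c * e) - e * (c - c * e)
        + ((star a * a - c - (star a * a - c) * e) - e * (star a * a - c - (star a * a - c) * e)) := by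
      simp only [star_sub, star_mul, hse, mul_sub, sub_mul, mul_assoc]
      abel
    calc ‖(proj a : I.Quotient)‖ * ‖(proj a : I.Quotient)‖
        ≤ ‖a - a * e‖ * ‖a - a * e‖ := by
          rw [h1]
          exact mul_le_mul (norm_proj_le _) (norm_proj_le _) (norm_nonneg _) (norm_nonneg _)
      _ = ‖star (a - a * e) * (a - a * e)‖ := CStarRing.norm_star_mul_self.symm
      _ ≤ ‖c‖ + ‖star a * a - c - (star a * a - c) * e‖ := by
          rw [h2]
          exact (norm_add_le _ _).trans (add_le_add ((hcl _).trans (hcontr _)) (hcl _))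
      _ ≤ ‖(proj (star a * a) : I.Quotient)‖ + δ := by linarith

/-- The quotient of a C*-algebra by a closed ideal is a C*-algebra. -/
instance : NonUnitalCStarAlgebra I.Quotient where

end Quotient

/-- The quotient map `B → B / I`. -/
def quotientMap : B →⋆ₙₐ[ℂ] I.Quotient where
  toFun := Quotient.proj
  map_smul' := map_smul Quotient.proj
  map_zero' := map_zero Quotient.proj
  map_add' := map_add Quotient.proj
  map_mul' := Quotient.proj_mul
  map_star' := Quotient.proj_star

/-- The canonical map `B / I → B / J` for `I ⊆ J`. -/
def factor {I J : ClosedIdeal B} (h : I ≤ J) : I.Quotient →⋆ₙₐ[ℂ] J.Quotient where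
  toFun := Submodule.mapQ I.toSubmodule J.toSubmodule LinearMap.id fun _ hx => h hx
  map_smul' := map_smul _
  map_zero' := map_zero _
  map_add' := map_add _
  map_mul' x y := by
    obtain ⟨a, rfl⟩ := Quotient.proj_surjective x
    obtain ⟨b, rfl⟩ := Quotient.proj_surjective y
    rfl
  map_star' x := by
    obtain ⟨a, rfl⟩ := Quotient.proj_surjective x
    rfl

theorem factor_quotientMap {I J : ClosedIdeal B} (h : I ≤ J) (b : B) : factor h (I.quotientMap b) = J.quotientMap b := rfl

end ClosedIdeal

/-- A C*-algebra `A` is semiprojective if it is separable and, for every C*-algebra `B`, every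
increasing sequence `J 0 ⊆ J 1 ⊆ ⋯` of closed two-sided ideals of `B` with `K` the closure of
their union, and every *-homomorphism `φ : A → B / K`, there are `n` and a *-homomorphism
`ψ : A → B / J n` that lifts `φ` along the canonical map `B / J n → B / K`. -/
structure IsSemiprojective.{u₁, u₂} (A : Type u₁) [NonUnitalCStarAlgebra A] : Prop where
  separable : TopologicalSpace.SeparableSpace A
  exists_lift : ∀ (B : Type u₂) [NonUnitalCStarAlgebra B] (J : ℕ → ClosedIdeal B)
    (K : ClosedIdeal B) (_ : Monotone J) (_ : (K : Set B) = closure (⋃ n, (J n : Set B)))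
    (hJK : ∀ n, J n ≤ K) (φ : A →⋆ₙₐ[ℂ] K.Quotient),
    ∃ (n : ℕ) (ψ : A →⋆ₙₐ[ℂ] (J n).Quotient), (ClosedIdeal.factor (hJK n)).comp ψ = φ

/-! ## NC *-polynomials -/

/-- The involution on words in the letters `x` (coded `(x, false)`) and `x*` (coded `(x, true)`):
reverse the word and exchange `x` and `x*`. -/
def starWord {X : Type*} (w : FreeMonoid (X × Bool)) : FreeMonoid (X × Bool) :=
  FreeMonoid.map (fun p => (p.1, !p.2)) (star w)

theorem starWord_mul {X : Type*} (v w : FreeMonoid (X × Bool)) :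
    starWord (v * w) = starWord w * starWord v := by
  simp [starWord]

theorem starWord_of {X : Type*} (x : X) (b : Bool) :
    starWord (FreeMonoid.of (x, b)) = FreeMonoid.of (x, !b) := by
  simp [starWord]

theorem starWord_starWord {X : Type*} (w : FreeMonoid (X × Bool)) :
    starWord (starWord w) = w := by
  induction w using FreeMonoid.inductionOn' with
  | one => rfl
  | of_mul p w ih => rw [starWord_mul, starWord_mul, ih, starWord_of, starWord_of, Bool.not_not]

/-- NC *-polynomials in the variables `X` (constant terms allowed): the free unital complex
*-algebra on `X`. -/
def NCStarPoly (X : Type*) : Type _ := MonoidAlgebra ℂ (FreeMonoid (X × Bool))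

namespace NCStarPoly

variable {X : Type*}

instance : Ring (NCStarPoly X) := inferInstanceAs (Ring (MonoidAlgebra ℂ (FreeMonoid (X × Bool))))

instance : Algebra ℂ (NCStarPoly X) :=
  inferInstanceAs (Algebra ℂ (MonoidAlgebra ℂ (FreeMonoid (X × Bool))))

/-- The monomial `c w`. -/
def monomial (w : FreeMonoid (X × Bool)) (c : ℂ) : NCStarPoly X := MonoidAlgebra.single w c

theorem induction_linear {motive : NCStarPoly X → Prop} (p : NCStarPoly X) (zero : motive 0)
    (add : ∀ p q, motive p → motive q → motive (p + q)) (mon : ∀ w c, motive (monomial w c)) :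
    motive p :=
  MonoidAlgebra.induction_linear p zero add mon

theorem monomial_mul (v w : FreeMonoid (X × Bool)) (c d : ℂ) :
    monomial v c * monomial w d = monomial (v * w) (c * d) :=
  MonoidAlgebra.single_mul_single ..

theorem smul_monomial (a : ℂ) (w : FreeMonoid (X × Bool)) (c : ℂ) :
    a • monomial w c = monomial w (a * c) :=
  MonoidAlgebra.smul_single' ..

/-- The additive map with `c w ↦ conj(c) w*`. -/
def starAux : NCStarPoly X →+ NCStarPoly X :=
  ((Finsupp.liftAddHom fun w : FreeMonoid (X × Bool) =>
    (MonoidAlgebra.singleAddHom (R := ℂ) (starWord w)).comp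
      (starRingEnd ℂ).toAddMonoidHom).comp
    (MonoidAlgebra.coeffAddEquiv (R := ℂ) (M := FreeMonoid (X × Bool))).toAddMonoidHom :
    MonoidAlgebra ℂ (FreeMonoid (X × Bool)) →+ MonoidAlgebra ℂ (FreeMonoid (X × Bool)))

theorem starAux_monomial (w : FreeMonoid (X × Bool)) (c : ℂ) :
    starAux (monomial w c) = monomial (starWord w) (starRingEnd ℂ c) := by
  exact Finsupp.liftAddHom_apply_single (fun w : FreeMonoid (X × Bool) =>
    (MonoidAlgebra.singleAddHom (R := ℂ) (starWord w)).comp (starRingEnd ℂ).toAddMonoidHom) w c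

instance : StarRing (NCStarPoly X) where
  star := starAux
  star_involutive p := by
    induction p using induction_linear with
    | zero => simp
    | add p q hp hq => rw [map_add, map_add, hp, hq]
    | mon w c => rw [starAux_monomial, starAux_monomial, starWord_starWord, Complex.conj_conj]
  star_add := map_add starAux
  star_mul p q := by
    change starAux (p * q) = starAux q * starAux p
    induction p using induction_linear with
    | zero => simp
    | add p p' hp hp' => rw [add_mul, map_add, hp, hp', map_add, mul_add]
    | mon v c =>
      induction q using induction_linear with
      | zero => simp
      | add q q' hq hq' => rw [mul_add, map_add, hq, hq', map_add, add_mul]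
      | mon w d =>
        rw [monomial_mul, starAux_monomial, starAux_monomial, starAux_monomial, monomial_mul,
          starWord_mul, map_mul, mul_comm]

theorem star_monomial (w : FreeMonoid (X × Bool)) (c : ℂ) :
    star (monomial w c) = monomial (starWord w) (starRingEnd ℂ c) := starAux_monomial w c

instance : StarModule ℂ (NCStarPoly X) where
  star_smul a p := by
    induction p using induction_linear with
    | zero => simp
    | add p q hp hq => rw [smul_add, star_add, hp, hq, star_add, smul_add]
    | mon w c =>
      rw [smul_monomial, star_monomial, star_monomial, smul_monomial, map_mul]
      rfl

/-- The variable `x`, as an NC *-polynomial. -/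
def var (x : X) : NCStarPoly X := monomial (FreeMonoid.of (x, false)) 1

section eval

variable {B : Type*} [Ring B] [StarRing B]

/-- The value of a word at a tuple of elements of a *-algebra. -/
def evalWord (b : X → B) : FreeMonoid (X × Bool) →* B :=
  FreeMonoid.lift fun p => if p.2 then star (b p.1) else b p.1

theorem evalWord_starWord (b : X → B) (w : FreeMonoid (X × Bool)) :
    evalWord b (starWord w) = star (evalWord b w) := by
  induction w using FreeMonoid.inductionOn' with
  | one => simp [starWord]
  | of_mul p w ih =>
    obtain ⟨x, t⟩ := p
    rw [starWord_mul, map_mul, map_mul, star_mul, ih, starWord_of]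
    cases t <;> simp [evalWord]

variable [Algebra ℂ B] [StarModule ℂ B]

/-- The value of an NC *-polynomial at a tuple of elements of a unital *-algebra, as a unital
*-homomorphism in the polynomial. -/
def eval (b : X → B) : NCStarPoly X →⋆ₐ[ℂ] B :=
  { (MonoidAlgebra.lift ℂ B (FreeMonoid (X × Bool)) (evalWord b) :
      MonoidAlgebra ℂ (FreeMonoid (X × Bool)) →ₐ[ℂ] B) with
    map_star' := fun p => by
      let f : NCStarPoly X →ₐ[ℂ] B :=
        MonoidAlgebra.lift ℂ B (FreeMonoid (X × Bool)) (evalWord b)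
      have hf (w c) : f (monomial w c) = c • evalWord b w := MonoidAlgebra.lift_single ..
      change f (star p) = star (f p)
      induction p using induction_linear with
      | zero => simp
      | add p q hp hq => rw [star_add, map_add, hp, hq, map_add, star_add]
      | mon w c => rw [star_monomial, hf, hf, evalWord_starWord, star_smul]; rfl }

theorem eval_monomial (b : X → B) (w : FreeMonoid (X × Bool)) (c : ℂ) :
    eval b (monomial w c) = c • evalWord b w := MonoidAlgebra.lift_single ..

theorem eval_var (b : X → B) (x : X) : eval b (var x) = b x := by
  rw [var, eval_monomial, one_smul]
  simp [evalWord]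

/-- *-homomorphisms on NC *-polynomials are evaluations. -/
theorem eq_eval (f : NCStarPoly X →⋆ₐ[ℂ] B) : f = eval fun x => f (var x) := by
  have hw (w : FreeMonoid (X × Bool)) : f (monomial w 1) = evalWord (fun x => f (var x)) w := by
    induction w using FreeMonoid.inductionOn' with
    | one => exact (map_one f).trans (map_one _).symm
    | of_mul p w ih =>
      have h1 : (monomial (FreeMonoid.of p * w) 1 : NCStarPoly X)
          = monomial (FreeMonoid.of p) 1 * monomial w 1 := by rw [monomial_mul, one_mul]
      rw [h1, map_mul, ih, map_mul]
      congr 1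
      obtain ⟨x, t⟩ := p
      cases t with
      | false => simp [evalWord, var]
      | true =>
        have : (monomial (FreeMonoid.of (x, true)) 1 : NCStarPoly X) = star (var x) := by
          rw [var, star_monomial, starWord_of, map_one]; rfl
        rw [this, map_star]
        simp [evalWord]
  ext p
  induction p using induction_linear with
  | zero => simp
  | add p q hp hq => rw [map_add, hp, hq, map_add]
  | mon w c =>
    have : (monomial w c : NCStarPoly X) = c • monomial w 1 := by rw [smul_monomial, mul_one]
    rw [this, map_smul, hw, map_smul, eval_monomial, one_smul]

end eval

end NCStarPoly

/-! ## Hausdorff completions for C*-seminorms -/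

/-- A C*-seminorm on a unital complex *-algebra. -/
structure CStarSeminorm (P : Type*) [Ring P] [StarRing P] [Algebra ℂ P] extends Seminorm ℂ P where
  mul_le' : ∀ p q, toFun (p * q) ≤ toFun p * toFun q
  star_mul_self' : ∀ p, toFun (star p * p) = toFun p * toFun p

namespace CStarSeminorm

variable {P : Type*} [Ring P] [StarRing P] [Algebra ℂ P]

/-- The *-algebra `P`, seen as a seminormed algebra by means of `s`. -/
@[nolint unusedArguments]
def Pre (_ : CStarSeminorm P) : Type _ := P

variable (s : CStarSeminorm P)

instance : Ring s.Pre := inferInstanceAs (Ring P)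
instance : StarRing s.Pre := inferInstanceAs (StarRing P)
instance instAlgebraPre : Algebra ℂ s.Pre := inferInstanceAs (Algebra ℂ P)
instance [StarModule ℂ P] : StarModule ℂ s.Pre := inferInstanceAs (StarModule ℂ P)

instance : SeminormedRing s.Pre :=
  { (inferInstance : Ring s.Pre),
    AddGroupSeminorm.toSeminormedAddCommGroup (E := P) s.toSeminorm.toAddGroupSeminorm with
    norm_mul_le := s.mul_le' }

theorem norm_pre (p : s.Pre) : ‖p‖ = s.toSeminorm p := rfl

instance : NormedAlgebra ℂ s.Pre where
  toAlgebra := s.instAlgebraPre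
  norm_smul_le c p := (map_smul_eq_mul s.toSeminorm c p).le

theorem norm_star_mul_self_pre (p : s.Pre) : ‖star p * p‖ = ‖p‖ * ‖p‖ := s.star_mul_self' p

theorem norm_star_pre (p : s.Pre) : ‖star p‖ = ‖p‖ := by
  have key (q : s.Pre) : ‖q‖ ≤ ‖star q‖ := by
    rcases (norm_nonneg q).eq_or_lt with h | h
    · rw [← h]; exact norm_nonneg _
    · refine le_of_mul_le_mul_right ?_ h
      rw [← norm_star_mul_self_pre]
      exact norm_mul_le _ _
  exact le_antisymm (by simpa using key (star p)) (key p)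

theorem uniformContinuous_star : UniformContinuous (star : s.Pre → s.Pre) := by
  refine (AddMonoidHomClass.isometry_of_norm (starAddEquiv : s.Pre ≃+ s.Pre) ?_).uniformContinuous
  exact s.norm_star_pre

open UniformSpace

/-- The C*-algebra obtained from a C*-seminorm `s` on `P`: the Hausdorff completion of `P`. -/
def Envelope : Type _ := Completion s.Pre

namespace Envelope

instance : NormedRing s.Envelope := inferInstanceAs (NormedRing (Completion s.Pre))
instance instAlgebra : Algebra ℂ s.Envelope := inferInstanceAs (Algebra ℂ (Completion s.Pre))
instance : CompleteSpace s.Envelope := inferInstanceAs (CompleteSpace (Completion s.Pre))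

instance : NormedAlgebra ℂ s.Envelope where
  toAlgebra := instAlgebra s
  norm_smul_le := norm_smul_le (α := ℂ) (β := Completion s.Pre)

variable {s}

/-- The image in the completion of an element of `P`. -/
def ofP (p : P) : s.Envelope := ((show s.Pre from p : s.Pre) : Completion s.Pre)

theorem denseRange_ofP : DenseRange (ofP : P → s.Envelope) :=
  Completion.denseRange_coe (α := s.Pre)

theorem norm_ofP (p : P) : ‖(ofP p : s.Envelope)‖ = s.toSeminorm p :=
  Completion.norm_coe (E := s.Pre) p

theorem ofP_add (p q : P) : (ofP (p + q) : s.Envelope) = ofP p + ofP q :=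
  Completion.coe_add (α := s.Pre) p q

theorem ofP_mul (p q : P) : (ofP (p * q) : s.Envelope) = ofP p * ofP q :=
  Completion.coe_mul (α := s.Pre) p q

theorem ofP_smul (c : ℂ) (p : P) : (ofP (c • p) : s.Envelope) = c • ofP p :=
  Completion.coe_smul (X := s.Pre) c p

/-- The continuous extension of the involution of `P`. -/
instance : Star s.Envelope where
  star := Completion.map (star : s.Pre → s.Pre)

theorem ofP_star (p : P) : (ofP (star p) : s.Envelope) = star (ofP p) :=
  (Completion.map_coe s.uniformContinuous_star p).symm

theorem continuous_star' : Continuous (star : s.Envelope → s.Envelope) :=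
  Completion.continuous_map

instance : StarRing s.Envelope where
  star_involutive x := by
    refine denseRange_ofP.induction_on (p := fun x : s.Envelope => star (star x) = x) x
      (isClosed_eq (continuous_star'.comp continuous_star') continuous_id) fun p => ?_
    rw [← ofP_star, ← ofP_star, star_star]
  star_mul x y := by
    refine denseRange_ofP.induction_on₂
      (p := fun x y : s.Envelope => star (x * y) = star y * star x) ?_ (fun p q => ?_) x y
    · exact isClosed_eq (continuous_star'.comp continuous_mul)
        ((continuous_star'.comp continuous_snd).mul (continuous_star'.comp continuous_fst))
    · rw [← ofP_mul, ← ofP_star, star_mul, ofP_mul, ofP_star, ofP_star]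
  star_add x y := by
    refine denseRange_ofP.induction_on₂
      (p := fun x y : s.Envelope => star (x + y) = star x + star y) ?_ (fun p q => ?_) x y
    · exact isClosed_eq (continuous_star'.comp continuous_add)
        ((continuous_star'.comp continuous_fst).add (continuous_star'.comp continuous_snd))
    · rw [← ofP_add, ← ofP_star, star_add, ofP_add, ofP_star, ofP_star]

instance [StarModule ℂ P] : StarModule ℂ s.Envelope where
  star_smul c x := by
    refine denseRange_ofP.induction_on (p := fun x : s.Envelope => star (c • x) = star c • star x) x
      (isClosed_eq (continuous_star'.comp (continuous_const_smul c))
        (continuous_star'.const_smul (star c))) fun p => ?_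
    rw [← ofP_smul, ← ofP_star, star_smul, ofP_smul, ofP_star]

instance : CStarRing s.Envelope where
  norm_mul_self_le x := by
    refine denseRange_ofP.induction_on
      (p := fun x : s.Envelope => ‖x‖ * ‖x‖ ≤ ‖star x * x‖) x
      (isClosed_le (continuous_norm.mul continuous_norm)
        (continuous_star'.mul continuous_id).norm) fun p => ?_
    rw [← ofP_star, ← ofP_mul, norm_ofP, norm_ofP]
    exact (s.star_mul_self' p).ge

instance [StarModule ℂ P] : CStarAlgebra s.Envelope where

end Envelope

variable [StarModule ℂ P]

/-- The canonical map from `P` to the completion. -/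
def toEnvelope : P →⋆ₐ[ℂ] s.Envelope where
  toFun := Envelope.ofP
  map_one' := rfl
  map_mul' := Envelope.ofP_mul
  map_zero' := rfl
  map_add' := Envelope.ofP_add
  commutes' c := by
    rw [Algebra.algebraMap_eq_smul_one, Envelope.ofP_smul, Algebra.algebraMap_eq_smul_one]
    rfl
  map_star' := Envelope.ofP_star

theorem denseRange_toEnvelope : DenseRange s.toEnvelope := Envelope.denseRange_ofP

theorem norm_toEnvelope (p : P) : ‖s.toEnvelope p‖ = s.toSeminorm p := Envelope.norm_ofP p

/-- *-homomorphisms that are bounded by `s` extend to the completion. -/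
theorem exists_extension {B : Type*} [CStarAlgebra B] (f : P →⋆ₐ[ℂ] B)
    (hf : ∀ p, ‖f p‖ ≤ s.toSeminorm p) :
    ∃ g : s.Envelope →⋆ₐ[ℂ] B, ∀ p, g (s.toEnvelope p) = f p := by
  let f' : s.Pre →+ B := (f : P →+ B)
  have huc : UniformContinuous f' :=
    (AddMonoidHomClass.lipschitz_of_bound f' 1 fun p => by
      rw [one_mul]; exact hf p).uniformContinuous
  let g : s.Envelope → B := Completion.extension f'
  have hg : Continuous g := Completion.continuous_extension
  have hgf (p : P) : g (s.toEnvelope p) = f p := Completion.extension_coe huc p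
  refine ⟨{ toFun := g, map_one' := ?_, map_mul' := ?_, map_zero' := ?_, map_add' := ?_,
            commutes' := ?_, map_star' := ?_ }, hgf⟩
  · rw [← map_one s.toEnvelope, hgf, map_one]
  · refine s.denseRange_toEnvelope.induction_on₂
      (isClosed_eq (by fun_prop) (by fun_prop)) fun p q => ?_
    rw [← map_mul, hgf, hgf, hgf, map_mul]
  · rw [← map_zero s.toEnvelope, hgf, map_zero]
  · refine s.denseRange_toEnvelope.induction_on₂
      (isClosed_eq (by fun_prop) (by fun_prop)) fun p q => ?_
    rw [← map_add, hgf, hgf, hgf, map_add]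
  · intro c
    rw [← AlgHomClass.commutes s.toEnvelope, hgf, AlgHomClass.commutes]
  · intro x
    refine s.denseRange_toEnvelope.induction_on (p := fun x => g (star x) = star (g x)) x
      (isClosed_eq (hg.comp continuous_star) (hg.star)) fun p => ?_
    rw [← map_star, hgf, hgf, map_star]

/-- The C*-seminorm `‖f p‖`. -/
def ofHom {B : Type*} [CStarAlgebra B] (f : P →⋆ₐ[ℂ] B) : CStarSeminorm P where
  toFun p := ‖f p‖
  map_zero' := by simp
  add_le' p q := by rw [map_add]; exact norm_add_le _ _
  neg' p := by rw [map_neg, norm_neg]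
  smul' c p := by rw [map_smul, norm_smul]
  mul_le' p q := by simpa using norm_mul_le (f p) (f q)
  star_mul_self' p := by
    rw [map_mul, map_star, CStarRing.norm_star_mul_self]

end CStarSeminorm

/-! ## The soft cylinder -/

/-- The relations of the soft cylinder, for elements `u`, `h` of a unital C*-algebra:
`u* u = u u* = 1`, `-1 ≤ h ≤ 1` (in the order of the C*-algebra, in which `0 ≤ a` means that `a`
is self-adjoint with nonnegative spectrum), and `‖u h - h u‖ ≤ ε`. -/
structure SoftCylinderRel (ε : ℝ) {B : Type*} [CStarAlgebra B] (u h : B) : Prop where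
  star_mul_self : star u * u = 1
  mul_star_self : u * star u = 1
  neg_one_le : (CStarAlgebra.spectralOrder B).le (-1) h
  le_one : (CStarAlgebra.spectralOrder B).le h 1
  norm_comm_le : ‖u * h - h * u‖ ≤ ε

theorem between_neg_one_one_iff {B : Type*} [CStarAlgebra B] (h : B) :
    ((CStarAlgebra.spectralOrder B).le (-1) h ∧ (CStarAlgebra.spectralOrder B).le h 1) ↔
      star h = h ∧ ‖h‖ ≤ 1 := by
  let _ := CStarAlgebra.spectralOrder B
  let _ := CStarAlgebra.spectralOrderedRing B
  change (-1 ≤ h ∧ h ≤ 1) ↔ _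
  constructor
  · rintro ⟨h1, h2⟩
    have hsa : IsSelfAdjoint h := by
      have : IsSelfAdjoint (1 - h) := .of_nonneg (sub_nonneg.2 h2)
      simpa using (IsSelfAdjoint.one B).sub this
    refine ⟨hsa, ?_⟩
    cases subsingleton_or_nontrivial B
    · simp [Subsingleton.elim h 0]
    rw [← map_one (algebraMap ℝ B)] at h1 h2
    rw [← map_neg] at h1
    have hu := (le_algebraMap_iff_spectrum_le (a := h) hsa).1 h2
    have hl := (algebraMap_le_iff_le_spectrum (a := h) hsa).1 h1
    rcases CStarAlgebra.norm_or_neg_norm_mem_spectrum hsa with hm | hm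
    · exact hu _ hm
    · exact neg_le_neg_iff.1 (hl _ hm)
  · rintro ⟨hsa, hn⟩
    have hsa' : IsSelfAdjoint h := hsa
    have hle : algebraMap ℝ B ‖h‖ ≤ 1 := by
      rw [← map_one (algebraMap ℝ B)]
      exact algebraMap_mono B hn
    exact ⟨(neg_le_neg hle).trans hsa'.neg_algebraMap_norm_le_self,
      hsa'.le_algebraMap_norm_self.trans hle⟩

theorem softCylinderRel_iff {ε : ℝ} {B : Type*} [CStarAlgebra B] {u h : B} :
    SoftCylinderRel ε u h ↔ star u * u = 1 ∧ u * star u = 1 ∧ star h = h ∧ ‖h‖ ≤ 1 ∧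
      ‖u * h - h * u‖ ≤ ε := by
  constructor
  · rintro ⟨h1, h2, h3, h4, h5⟩
    obtain ⟨h6, h7⟩ := (between_neg_one_one_iff h).1 ⟨h3, h4⟩
    exact ⟨h1, h2, h6, h7, h5⟩
  · rintro ⟨h1, h2, h3, h4, h5⟩
    obtain ⟨h6, h7⟩ := (between_neg_one_one_iff h).2 ⟨h3, h4⟩
    exact ⟨h1, h2, h6, h7, h5⟩

namespace SoftCylinder

open NCStarPoly

/-- The values `‖p(u, h)‖`, where `u`, `h` run over the pairs of elements of unital C*-algebras
that satisfy the relations of the soft cylinder. -/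
def normValues (ε : ℝ) (p : NCStarPoly (Fin 2)) : Set ℝ :=
  {r | ∃ (B : Type) (_ : CStarAlgebra B) (u h : B),
    SoftCylinderRel ε u h ∧ r = ‖eval ![u, h] p‖}

theorem bddAbove_normValues (ε : ℝ) (p : NCStarPoly (Fin 2)) : BddAbove (normValues ε p) := by
  have hone (B : Type) [CStarAlgebra B] : ‖(1 : B)‖ ≤ 1 := by
    cases subsingleton_or_nontrivial B
    · simp [Subsingleton.elim (1 : B) 0]
    · exact CStarRing.norm_one.le
  have hw (w : FreeMonoid (Fin 2 × Bool)) (B : Type) [CStarAlgebra B] (u h : B)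
      (hr : SoftCylinderRel ε u h) : ‖evalWord ![u, h] w‖ ≤ 1 := by
    induction w using FreeMonoid.inductionOn' with
    | one => rw [map_one]; exact hone B
    | of_mul q w ih =>
      obtain ⟨x, t⟩ := q
      rw [map_mul]
      refine (norm_mul_le _ _).trans (mul_le_one₀ ?_ (norm_nonneg _) ih)
      have hx : ‖(![u, h] : Fin 2 → B) x‖ ≤ 1 := by
        fin_cases x
        · change ‖u‖ ≤ 1
          have h2 : ‖u‖ * ‖u‖ ≤ 1 := by
            rw [← CStarRing.norm_star_mul_self, hr.star_mul_self]; exact hone B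
          nlinarith [norm_nonneg u]
        · exact (softCylinderRel_iff.1 hr).2.2.2.1
      cases t
      · simpa [evalWord] using hx
      · simpa [evalWord, norm_star] using hx
  induction p using NCStarPoly.induction_linear with
  | zero =>
    refine ⟨0, ?_⟩
    rintro r ⟨B, _, u, h, _, rfl⟩
    simp
  | add p q hp hq =>
    obtain ⟨C, hC⟩ := hp
    obtain ⟨D, hD⟩ := hq
    refine ⟨C + D, ?_⟩
    rintro r ⟨B, _, u, h, hr, rfl⟩
    rw [map_add]
    exact (norm_add_le _ _).trans
      (add_le_add (hC ⟨B, _, u, h, hr, rfl⟩) (hD ⟨B, _, u, h, hr, rfl⟩))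
  | mon w c =>
    refine ⟨‖c‖, ?_⟩
    rintro r ⟨B, _, u, h, hr, rfl⟩
    rw [eval_monomial, norm_smul]
    exact mul_le_of_le_one_right (norm_nonneg c) (hw w B u h hr)

/-- The supremum of `‖p(u, h)‖` over all pairs `u`, `h` that satisfy the relations. -/
def supNorm (ε : ℝ) (p : NCStarPoly (Fin 2)) : ℝ := sSup (normValues ε p)

theorem supNorm_nonneg (ε : ℝ) (p : NCStarPoly (Fin 2)) : 0 ≤ supNorm ε p := by
  refine Real.sSup_nonneg ?_
  rintro r ⟨B, _, u, h, _, rfl⟩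
  exact norm_nonneg _

theorem le_supNorm {ε : ℝ} {B : Type} [CStarAlgebra B] {u h : B} (hr : SoftCylinderRel ε u h)
    (p : NCStarPoly (Fin 2)) : ‖eval ![u, h] p‖ ≤ supNorm ε p :=
  le_csSup (bddAbove_normValues ε p) ⟨B, _, u, h, hr, rfl⟩

theorem supNorm_le {ε : ℝ} {p : NCStarPoly (Fin 2)} {C : ℝ} (hC : 0 ≤ C)
    (hp : ∀ (B : Type) [CStarAlgebra B] (u h : B), SoftCylinderRel ε u h →
      ‖eval ![u, h] p‖ ≤ C) : supNorm ε p ≤ C := by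
  refine Real.sSup_le ?_ hC
  rintro r ⟨B, _, u, h, hr, rfl⟩
  exact hp B u h hr

/-- The largest C*-seminorm on NC *-polynomials in `u`, `h` that comes from the relations of the
soft cylinder. -/
def seminorm (ε : ℝ) : CStarSeminorm (NCStarPoly (Fin 2)) where
  toSeminorm := Seminorm.of (supNorm ε)
    (fun p q => supNorm_le (add_nonneg (supNorm_nonneg ε p) (supNorm_nonneg ε q))
      fun B _ u h hr => by
        rw [map_add]
        exact (norm_add_le _ _).trans (add_le_add (le_supNorm hr p) (le_supNorm hr q)))
    (by
      have key (c : ℂ) (p : NCStarPoly (Fin 2)) : supNorm ε (c • p) ≤ ‖c‖ * supNorm ε p :=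
        supNorm_le (mul_nonneg (norm_nonneg c) (supNorm_nonneg ε p)) fun B _ u h hr => by
          rw [map_smul, norm_smul]
          exact mul_le_mul_of_nonneg_left (le_supNorm hr p) (norm_nonneg c)
      intro c p
      refine le_antisymm (key c p) ?_
      rcases eq_or_ne c 0 with rfl | hc
      · simpa using supNorm_nonneg ε _
      · have h1 := key c⁻¹ (c • p)
        rw [inv_smul_smul₀ hc, norm_inv] at h1
        have h2 := mul_le_mul_of_nonneg_left h1 (norm_nonneg c)
        rwa [mul_inv_cancel_left₀ (norm_ne_zero_iff.2 hc)] at h2)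
  mul_le' p q := supNorm_le (mul_nonneg (supNorm_nonneg ε p) (supNorm_nonneg ε q))
    fun B _ u h hr => by
      rw [map_mul]
      exact (norm_mul_le _ _).trans (mul_le_mul (le_supNorm hr p) (le_supNorm hr q)
        (norm_nonneg _) (supNorm_nonneg ε p))
  star_mul_self' p := by
    change supNorm ε (star p * p) = supNorm ε p * supNorm ε p
    have hid (B : Type) [CStarAlgebra B] (u h : B) :
        ‖eval ![u, h] (star p * p)‖ = ‖eval ![u, h] p‖ * ‖eval ![u, h] p‖ := by
      rw [map_mul, map_star, CStarRing.norm_star_mul_self]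
    refine le_antisymm ?_ ?_
    · refine supNorm_le (mul_nonneg (supNorm_nonneg ε p) (supNorm_nonneg ε p))
        fun B _ u h hr => ?_
      rw [hid]
      exact mul_self_le_mul_self (norm_nonneg _) (le_supNorm hr p)
    · have hs : supNorm ε p ≤ √(supNorm ε (star p * p)) :=
        supNorm_le (Real.sqrt_nonneg _) fun B _ u h hr => by
          refine Real.le_sqrt_of_sq_le ?_
          rw [sq, ← hid]
          exact le_supNorm hr _
      calc supNorm ε p * supNorm ε p
          ≤ √(supNorm ε (star p * p)) * √(supNorm ε (star p * p)) :=
            mul_self_le_mul_self (supNorm_nonneg ε p) hs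
        _ = supNorm ε (star p * p) := Real.mul_self_sqrt (supNorm_nonneg ε _)

end SoftCylinder

/-- The soft cylinder `A_ε = C*₁⟨u, h | u* u = u u* = 1, -1 ≤ h ≤ 1, ‖u h - h u‖ ≤ ε⟩`: the
universal unital C*-algebra for these relations, constructed as the Hausdorff completion of the
NC *-polynomials in `u`, `h` for the supremum of the seminorms `p ↦ ‖p(u, h)‖` over all pairs `u`,
`h` in unital C*-algebras that satisfy the relations. -/
def SoftCylinder (ε : ℝ) : Type := (SoftCylinder.seminorm ε).Envelope

namespace SoftCylinder

open NCStarPoly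

instance (ε : ℝ) : CStarAlgebra (SoftCylinder ε) :=
  inferInstanceAs (CStarAlgebra (SoftCylinder.seminorm ε).Envelope)

/-- The canonical map from NC *-polynomials to the soft cylinder. -/
def ofPoly (ε : ℝ) : NCStarPoly (Fin 2) →⋆ₐ[ℂ] SoftCylinder ε := (seminorm ε).toEnvelope

theorem denseRange_ofPoly (ε : ℝ) : DenseRange (ofPoly ε) := (seminorm ε).denseRange_toEnvelope

theorem norm_ofPoly (ε : ℝ) (p : NCStarPoly (Fin 2)) : ‖ofPoly ε p‖ = supNorm ε p :=
  (seminorm ε).norm_toEnvelope p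

/-- The generator `u` of the soft cylinder. -/
def u (ε : ℝ) : SoftCylinder ε := ofPoly ε (var 0)

/-- The generator `h` of the soft cylinder. -/
def h (ε : ℝ) : SoftCylinder ε := ofPoly ε (var 1)

/-- The generators satisfy the relations. -/
theorem rel {ε : ℝ} (hε : 0 ≤ ε) : SoftCylinderRel ε (u ε) (h ε) := by
  have hz (p : NCStarPoly (Fin 2))
      (hp : ∀ (B : Type) [CStarAlgebra B] (v k : B), SoftCylinderRel ε v k →
        eval ![v, k] p = 0) : ofPoly ε p = 0 := by
    rw [← norm_le_zero_iff, norm_ofPoly]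
    exact supNorm_le le_rfl fun B _ v k hr => by rw [hp B v k hr, norm_zero]
  rw [softCylinderRel_iff]
  refine ⟨?_, ?_, ?_, ?_, ?_⟩
  · rw [u, ← map_star, ← map_mul, ← map_one (ofPoly ε), ← sub_eq_zero, ← map_sub]
    refine hz _ fun B _ v k hr => ?_
    simp [eval_var, hr.star_mul_self, map_star]
  · rw [u, ← map_star, ← map_mul, ← map_one (ofPoly ε), ← sub_eq_zero, ← map_sub]
    refine hz _ fun B _ v k hr => ?_
    simp [eval_var, hr.mul_star_self, map_star]
  · rw [h, ← map_star, ← sub_eq_zero, ← map_sub]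
    refine hz _ fun B _ v k hr => ?_
    simp [eval_var, (softCylinderRel_iff.1 hr).2.2.1, map_star]
  · rw [h, norm_ofPoly]
    refine supNorm_le zero_le_one fun B _ v k hr => ?_
    simpa [eval_var] using (softCylinderRel_iff.1 hr).2.2.2.1
  · rw [u, h, ← map_mul, ← map_mul, ← map_sub, norm_ofPoly]
    refine supNorm_le hε fun B _ v k hr => ?_
    simpa [eval_var] using hr.norm_comm_le

/-- The universal property of the soft cylinder. -/
theorem existsUnique_hom {ε : ℝ} {B : Type*} [CStarAlgebra B] {v k : B}
    (hr : SoftCylinderRel ε v k) :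
    ∃! f : SoftCylinder ε →⋆ₐ[ℂ] B, f (u ε) = v ∧ f (h ε) = k := by
  let s := CStarSeminorm.ofHom (eval ![v, k])
  have hs (p : NCStarPoly (Fin 2)) : ‖s.toEnvelope p‖ = ‖eval ![v, k] p‖ := s.norm_toEnvelope p
  have hz (p : NCStarPoly (Fin 2)) (hp : eval ![v, k] p = 0) : s.toEnvelope p = 0 := by
    rw [← norm_eq_zero, hs, hp, norm_zero]
  have hrs : SoftCylinderRel ε (s.toEnvelope (var 0)) (s.toEnvelope (var 1)) := by
    have hr' := softCylinderRel_iff.1 hr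
    rw [softCylinderRel_iff]
    refine ⟨?_, ?_, ?_, ?_, ?_⟩
    · rw [← map_star, ← map_mul, ← map_one s.toEnvelope, ← sub_eq_zero, ← map_sub]
      exact hz _ (by simp [eval_var, hr'.1, map_star])
    · rw [← map_star, ← map_mul, ← map_one s.toEnvelope, ← sub_eq_zero, ← map_sub]
      exact hz _ (by simp [eval_var, hr'.2.1, map_star])
    · rw [← map_star, ← sub_eq_zero, ← map_sub]
      exact hz _ (by simp [eval_var, hr'.2.2.1, map_star])
    · rw [hs]
      simpa [eval_var] using hr'.2.2.2.1
    · rw [← map_mul, ← map_mul, ← map_sub, hs]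
      simpa [eval_var] using hr.norm_comm_le
  have heq : s.toEnvelope = eval ![s.toEnvelope (var 0), s.toEnvelope (var 1)] := by
    rw [eq_eval s.toEnvelope]
    congr 1
    funext i
    fin_cases i <;> simp [eval_var]
  obtain ⟨f, hf⟩ := (seminorm ε).exists_extension (eval ![v, k]) fun p => by
    rw [← hs, heq]
    exact le_supNorm hrs p
  refine ⟨f, ⟨(hf _).trans (by simp [eval_var]), (hf _).trans (by simp [eval_var])⟩, ?_⟩
  rintro g ⟨hg1, hg2⟩
  have hcont (f : SoftCylinder ε →⋆ₐ[ℂ] B) : Continuous f :=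
    AddMonoidHomClass.continuous_of_bound f 1 fun x => by
      rw [one_mul]; exact NonUnitalStarAlgHom.norm_apply_le f x
  have hgp : g.comp (ofPoly ε) = eval ![v, k] := by
    rw [eq_eval (g.comp (ofPoly ε))]
    congr 1
    funext i
    fin_cases i
    · exact hg1
    · exact hg2
  refine DFunLike.coe_injective ((denseRange_ofPoly ε).equalizer (hcont g) (hcont f) ?_)
  funext p
  exact (DFunLike.congr_fun hgp p).trans (hf p).symm

end SoftCylinder

end

/-! The point is that the norm bound on the commutator lifts without loss through an arbitrary
quotient once `u` has been lifted to a unitary; only the unit and `u` force a passage far along the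
sequence `J n`.

For unitary `u`, `‖u h - h u‖ = ‖u h u* - h‖`, and for fixed `u` the conditions on `h` are convex.
Start with a self-adjoint contraction `h` for which `a = u h u* - h` is within `ε` of the ideal `I`,
in the sense of distance, while `‖a‖ ≤ ε (1 + d)`. A quasicentral approximate unit of `I`
(`ClosedIdeal.exists_quasicentral`) supplies `y ∈ I` that almost commutes with `u` and `h`; put `x =
√(1 - y²)`. Then `k = x h x + y (t h) y` with `t = 1 / (1 + d)` interpolates between `h` modulo `I`
and the scaled element `t h` inside `I`. Up to small errors `u k u* - k` is `x a x + y (t a) y`. The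
factor `x` sees almost only the part of `a` that survives modulo `I`, of norm about `ε`, and `t a`
has norm at most `ε`. As `x² + y² = 1`, the combination has norm about `ε` again
(`norm_conj_add_conj_le`). So `d` is halved at the cost of moving `h` by at most `2 d`
(`ClosedIdeal.exists_improvement`); these moves are summable and their limit reaches the bound `ε`
exactly (`ClosedIdeal.exists_norm_conj_sub_le`).

For semiprojectivity, the image of `1` lifts to a projection and the image of `u` to an almost
unitary of its corner over some `B / J n`, because quotient norms converge along the sequence
(`ClosedIdeal.exists_norm_quotientMap_lt`) and these relations are stable under functional calculus.
In `SoftCylinder.exists_lift_of_almost_unitary` the almost unitary becomes a unitary, the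
perturbation result repairs `h`, and the universal property gives the lift. -/

noncomputable section

open Filter Topology

/-! ### Quasicentral approximate units. -/

namespace ClosedIdeal

variable {E : Type*} [CStarAlgebra E] (I : ClosedIdeal E)

/-- A filter of self-adjoint contractions of `I` that is an approximate unit of `I`. -/
structure IsApproxUnit (l : Filter E) : Prop where
  neBot : l.NeBot
  eventually_mem : ∀ᶠ e in l, e ∈ I ∧ IsSelfAdjoint e ∧ ‖e‖ ≤ 1
  tendsto_mul_right : ∀ j ∈ I, Tendsto (fun e => e * j) l (𝓝 j)
  tendsto_mul_left : ∀ j ∈ I, Tendsto (fun e => j * e) l (𝓝 j)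

theorem exists_isApproxUnit : ∃ l : Filter E, I.IsApproxUnit l := by
  have hS : IsClosed (I.toStarSubalgebra : Set E) := I.isClosed
  let _ : NonUnitalCStarAlgebra I.toStarSubalgebra :=
    NonUnitalStarSubalgebra.nonUnitalCStarAlgebra I.toStarSubalgebra
  let _ := CStarAlgebra.spectralOrder I.toStarSubalgebra
  let _ := CStarAlgebra.spectralOrderedRing I.toStarSubalgebra
  have hu := CStarAlgebra.increasingApproximateUnit I.toStarSubalgebra
  have := hu.neBot
  refine ⟨map ((↑) : I.toStarSubalgebra → E) (CStarAlgebra.approximateUnit I.toStarSubalgebra),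
    inferInstance, ?_, ?_, ?_⟩
  · rw [eventually_map]
    filter_upwards [hu.eventually_isSelfAdjoint, hu.eventually_norm] with e he hn
    exact ⟨e.2, congrArg Subtype.val he, hn⟩
  · intro j hj
    rw [tendsto_map'_iff]
    exact (continuous_subtype_val.tendsto _).comp (hu.tendsto_mul_right ⟨j, hj⟩)
  · intro j hj
    rw [tendsto_map'_iff]
    exact (continuous_subtype_val.tendsto _).comp (hu.tendsto_mul_left ⟨j, hj⟩)

namespace IsApproxUnit

variable {I} {l : Filter E} (hl : I.IsApproxUnit l)
include hl

/-- Let `b` in the unit ball of `I` almost attain the norm `s` of `φ` on `I`, and let `g` almost fix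
`b`. Then `w = i - g i` is almost orthogonal to `b`, as `b* w = (b - g b)* i`. So `‖b + θ w‖`
exceeds `1` only to order `θ²`, and a large `φ w` would push `φ (b + θ w)` above `s ‖b + θ w‖`. The
bound is uniform in `i`, which the commutator estimate needs. -/
theorem eventually_apply_sub_mul_le (φ : E →L[ℝ] ℝ) {η : ℝ} (hη : 0 < η) :
    ∀ᶠ g in l, ∀ i ∈ I, ‖i‖ ≤ 1 → |φ (i - g * i)| ≤ η := by
  let V : Set ℝ := {r | ∃ b ∈ I, ‖b‖ ≤ 1 ∧ φ b = r}
  have hV : BddAbove V := by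
    refine ⟨‖φ‖, ?_⟩
    rintro r ⟨b, -, hb, rfl⟩
    exact (le_abs_self _).trans ((φ.le_opNorm b).trans
      (mul_le_of_le_one_right (norm_nonneg φ) hb))
  have h0 : (0 : ℝ) ∈ V := ⟨0, I.zero_mem, by simp, by simp⟩
  set s := sSup V with hs
  have hs0 : 0 ≤ s := le_csSup hV h0
  have hsz (z : E) (hz : z ∈ I) : φ z ≤ s * ‖z‖ := by
    rcases eq_or_ne z 0 with rfl | hz0
    · simp
    have hn : 0 < ‖z‖ := norm_pos_iff.2 hz0
    have h1 : φ ((‖z‖⁻¹ : ℝ) • z) ≤ s := by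
      refine le_csSup hV ⟨_, ?_, ?_, rfl⟩
      · have := I.smul_mem ((‖z‖⁻¹ : ℝ) : ℂ) hz
        rwa [Complex.coe_smul] at this
      · rw [norm_smul, norm_inv, norm_norm, inv_mul_cancel₀ hn.ne']
    rw [map_smul, smul_eq_mul, inv_mul_le_iff₀ hn] at h1
    linarith
  -- The estimate below reads `s - θ² + θ φ w ≤ s (1 + 3 θ²)`, that is, `φ w ≤ θ (1 + 3 s) = η`.
  let θ := η / (1 + 3 * s)
  have hθ : 0 < θ := by positivity
  have hθη : θ * (1 + 3 * s) = η := div_mul_cancel₀ _ (by positivity)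
  obtain ⟨_, ⟨b, hb, hb1, rfl⟩, hbs⟩ :=
    exists_lt_of_lt_csSup ⟨0, h0⟩ (show s - θ ^ 2 < s by have := sq_pos_of_pos hθ; linarith)
  have hev := (Metric.tendsto_nhds.1 (hl.tendsto_mul_right b hb) θ hθ).and hl.eventually_mem
  filter_upwards [hev] with g hg
  obtain ⟨hgb, hgI, hgs, hg1⟩ := hg
  rw [dist_comm, dist_eq_norm] at hgb
  have key (i : E) (hi : i ∈ I) (hi1 : ‖i‖ ≤ 1) : φ (i - g * i) ≤ η := by
    set w := i - g * i with hw
    have hwI : w ∈ I := I.sub_mem hi (I.mul_left g hi)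
    have hw2 : ‖w‖ ≤ 2 := (norm_sub_le _ _).trans
      (by linarith [norm_mul_le g i, mul_le_one₀ hg1 (norm_nonneg i) hi1])
    have hbw : ‖star b * w‖ ≤ θ := by
      have : star b * w = star (b - g * b) * i := by
        rw [hw, star_sub, star_mul, hgs.star_eq]; noncomm_ring
      rw [this]
      refine (norm_mul_le _ _).trans ?_
      rw [norm_star]
      exact (mul_le_of_le_one_right (norm_nonneg _) hi1).trans hgb.le
    have hz : ‖b + θ • w‖ * ‖b + θ • w‖ ≤ 1 + 6 * θ ^ 2 := by
      rw [← CStarRing.norm_star_mul_self]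
      have : star (b + θ • w) * (b + θ • w) = star b * b + θ • (star b * w)
          + θ • star (star b * w) + (θ * θ) • (star w * w) := by
        simp only [star_add, star_smul, star_trivial, star_mul, star_star, add_mul, mul_add,
          smul_mul_assoc, mul_smul_comm, smul_add, smul_smul]
        abel
      rw [this]
      have e1 : ‖star b * b‖ ≤ 1 := by
        rw [CStarRing.norm_star_mul_self]; exact mul_le_one₀ hb1 (norm_nonneg b) hb1
      have e2 : ‖θ • (star b * w)‖ ≤ θ * θ := by
        rw [norm_smul, Real.norm_of_nonneg hθ.le]
        exact mul_le_mul_of_nonneg_left hbw hθ.le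
      have e3 : ‖θ • star (star b * w)‖ ≤ θ * θ := by
        rw [norm_smul, norm_star, Real.norm_of_nonneg hθ.le]
        exact mul_le_mul_of_nonneg_left hbw hθ.le
      have e4 : ‖(θ * θ) • (star w * w)‖ ≤ θ * θ * 4 := by
        rw [norm_smul, CStarRing.norm_star_mul_self, Real.norm_of_nonneg (by positivity)]
        refine mul_le_mul_of_nonneg_left ?_ (by positivity)
        nlinarith [norm_nonneg w]
      refine (norm_add₄_le).trans ?_
      linarith
    have hz1 : ‖b + θ • w‖ ≤ 1 + 3 * θ ^ 2 := by
      refine abs_le_of_sq_le_sq' ?_ (by positivity) |>.2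
      nlinarith [sq_nonneg (θ ^ 2)]
    have hzI : b + θ • w ∈ I := by
      refine I.add_mem hb ?_
      have := I.smul_mem (θ : ℂ) hwI
      rwa [Complex.coe_smul] at this
    have h1 := (hsz _ hzI).trans (mul_le_mul_of_nonneg_left hz1 hs0)
    rw [map_add, map_smul, smul_eq_mul] at h1
    have h2 : θ * φ w ≤ θ * η := by rw [← hθη]; nlinarith
    exact le_of_mul_le_mul_left h2 hθ
  intro i hi hi1
  refine abs_le.2 ⟨?_, key i hi hi1⟩
  have := key (-i) (I.neg_mem hi) (by rwa [norm_neg])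
  rw [mul_neg, ← neg_sub', map_neg] at this
  linarith

/-- The mirror image of the previous bound, applied to `φ ∘ star` and `i*`. -/
theorem eventually_apply_sub_mul_le' (φ : E →L[ℝ] ℝ) {η : ℝ} (hη : 0 < η) :
    ∀ᶠ g in l, ∀ i ∈ I, ‖i‖ ≤ 1 → |φ (i - i * g)| ≤ η := by
  filter_upwards [hl.eventually_mem,
    hl.eventually_apply_sub_mul_le (φ.comp (starL' ℝ : E ≃L[ℝ] E).toContinuousLinearMap) hη]
    with g hg hφ i hi hi1
  have := hφ (star i) (I.star_mem hi) (by rwa [norm_star])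
  simpa [hg.2.1.star_eq] using this

/-- Commutators with an approximate unit tend weakly to zero. -/
theorem tendsto_apply_commutator (φ : E →L[ℝ] ℝ) (x : E) :
    Tendsto (fun e => φ (e * x - x * e)) l (𝓝 0) := by
  have := hl.neBot
  rw [Metric.tendsto_nhds]
  intro η hη
  set c := 2 * ‖x‖ + 1 with hc
  have hc0 : 0 < c := by positivity
  have hη' : 0 < η / (4 * c) := by positivity
  have hηc : η / (4 * c) * c = η / 4 := by field_simp
  -- Fix one `g` before letting `e` vary. Uniformly in `e`, `φ` hardly changes when the commutator
  -- `y = e x - x e ∈ I` is replaced by `g y g = (g e) x g - g x (e g)`. This tends to `0` in norm,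
  -- because `g ∈ I` gives `g e → g` and `e g → g`.
  obtain ⟨g, ⟨hgI, hgs, hg1⟩, hgl, hgr⟩ := (hl.eventually_mem.and
    ((hl.eventually_apply_sub_mul_le φ hη').and (hl.eventually_apply_sub_mul_le' φ hη'))).exists
  have scale {y : E} (hy : y ∈ I) (hyc : ‖y‖ ≤ c) :
      |φ (y - g * y)| ≤ η / 4 ∧ |φ (y - y * g)| ≤ η / 4 := by
    have hyI : (c⁻¹ : ℝ) • y ∈ I := by
      have := I.smul_mem ((c⁻¹ : ℝ) : ℂ) hy
      rwa [Complex.coe_smul] at this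
    have hy1 : ‖(c⁻¹ : ℝ) • y‖ ≤ 1 := by
      rw [norm_smul, norm_inv, Real.norm_of_nonneg hc0.le]
      exact inv_mul_le_one_of_le₀ hyc hc0.le
    have h1 := hgl _ hyI hy1
    have h2 := hgr _ hyI hy1
    rw [mul_smul_comm, ← smul_sub, map_smul, smul_eq_mul, abs_mul, abs_of_pos (by positivity),
      inv_mul_le_iff₀ hc0, mul_comm, hηc] at h1
    rw [smul_mul_assoc, ← smul_sub, map_smul, smul_eq_mul, abs_mul, abs_of_pos (by positivity),
      inv_mul_le_iff₀ hc0, mul_comm, hηc] at h2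
    exact ⟨h1, h2⟩
  have ht : Tendsto (fun e => φ (g * e * (x * g) - g * x * (e * g))) l (𝓝 0) := by
    have h1 : Tendsto (fun e => g * e * (x * g) - g * x * (e * g)) l
        (𝓝 (g * (x * g) - g * x * g)) :=
      ((hl.tendsto_mul_left g hgI).mul_const _).sub ((hl.tendsto_mul_right g hgI).const_mul _)
    rw [mul_assoc, sub_self] at h1
    have h2 := (φ.continuous.tendsto 0).comp h1
    rwa [map_zero] at h2
  filter_upwards [hl.eventually_mem, Metric.tendsto_nhds.1 ht (η / 4) (by positivity)]
    with e he hφ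
  rw [Real.dist_0_eq_abs] at hφ ⊢
  set y := e * x - x * e with hy
  have hyI : y ∈ I := I.sub_mem (I.mul_right x he.1) (I.mul_left x he.1)
  have hyc : ‖y‖ ≤ c := by
    have h1 : ‖e * x‖ ≤ ‖x‖ := (norm_mul_le _ _).trans
      (mul_le_of_le_one_left (norm_nonneg x) he.2.2)
    have h2 : ‖x * e‖ ≤ ‖x‖ := (norm_mul_le _ _).trans
      (mul_le_of_le_one_right (norm_nonneg x) he.2.2)
    linarith [norm_sub_le (e * x) (x * e)]
  have hgy : ‖g * y‖ ≤ c := (norm_mul_le _ _).trans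
    ((mul_le_of_le_one_left (norm_nonneg y) hg1).trans hyc)
  have hdec : φ y = φ (y - g * y) + φ (g * y - g * y * g)
      + φ (g * e * (x * g) - g * x * (e * g)) := by
    rw [← map_add, ← map_add, hy]
    congr 1
    noncomm_ring
  rw [hdec]
  have h1 := (scale hyI hyc).1
  have h2 := (scale (I.mul_left g hyI) hgy).2
  have := abs_add_three (φ (y - g * y)) (φ (g * y - g * y * g))
    (φ (g * e * (x * g) - g * x * (e * g)))
  linarith

end IsApproxUnit

/-- Existence of quasicentral approximate units, for two elements of the algebra. -/
theorem exists_quasicentral {f : E} (hf : f ∈ I) (x z : E) {η : ℝ} (hη : 0 < η) :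
    ∃ y ∈ I, IsSelfAdjoint y ∧ ‖y‖ ≤ 1 ∧ ‖f - y * f‖ < η ∧ ‖y * x - x * y‖ < η ∧
      ‖y * z - z * y‖ < η := by
  obtain ⟨l, hl⟩ := I.exists_isApproxUnit
  have := hl.neBot
  let S : Set E := {y | (y ∈ I ∧ IsSelfAdjoint y ∧ ‖y‖ ≤ 1) ∧ ‖f - y * f‖ < η}
  let T : E →ₗ[ℝ] E × E :=
    (LinearMap.mulRight ℝ x - LinearMap.mulLeft ℝ x).prod
      (LinearMap.mulRight ℝ z - LinearMap.mulLeft ℝ z)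
  have hT (y : E) : T y = (y * x - x * y, y * z - z * y) := rfl
  have hS : Convex ℝ S := by
    intro a ha b hb s t hs ht hst
    refine ⟨⟨?_, ?_, ?_⟩, ?_⟩
    · have := I.add_mem (I.smul_mem (s : ℂ) ha.1.1) (I.smul_mem (t : ℂ) hb.1.1)
      rwa [Complex.coe_smul, Complex.coe_smul] at this
    · exact ((IsSelfAdjoint.all s).smul ha.1.2.1).add ((IsSelfAdjoint.all t).smul hb.1.2.1)
    · refine (norm_add_le _ _).trans ?_
      rw [norm_smul, norm_smul, Real.norm_of_nonneg hs, Real.norm_of_nonneg ht]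
      nlinarith [ha.1.2.2, hb.1.2.2]
    · have h1 : f - (s • a + t • b) * f = s • (f - a * f) + t • (f - b * f) := by
        rw [add_mul, smul_mul_assoc, smul_mul_assoc, smul_sub, smul_sub]
        nth_rewrite 1 [← one_smul ℝ f]
        rw [← hst, add_smul]
        abel
      have h2 : s • (f - a * f) + t • (f - b * f) ∈ Metric.ball (0 : E) η :=
        convex_ball 0 η (by simpa using ha.2) (by simpa using hb.2) hs ht hst
      rw [h1]
      simpa using h2
  have hev : ∀ᶠ e in l, e ∈ S := by
    filter_upwards [hl.eventually_mem, Metric.tendsto_nhds.1 (hl.tendsto_mul_right f hf) η hη]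
      with e he hd
    rw [dist_comm, dist_eq_norm] at hd
    exact ⟨he, hd⟩
  -- Weak convergence of the commutators to `0` becomes norm approximation on the convex set `S`: a
  -- functional separating `0` from `T '' S` would contradict the weak limit. The product `E × E`
  -- treats both commutators with the same convex combination.
  have h0 : (0 : E × E) ∈ closure (T '' S) := by
    by_contra hn
    obtain ⟨φ, c, hc0, hc⟩ :=
      geometric_hahn_banach_point_closed (hS.linear_image T).closure isClosed_closure hn
    rw [map_zero] at hc0
    have ht := (hl.tendsto_apply_commutator (φ.comp (ContinuousLinearMap.inl ℝ E E)) x).add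
      (hl.tendsto_apply_commutator (φ.comp (ContinuousLinearMap.inr ℝ E E)) z)
    rw [add_zero] at ht
    have hge : ∀ᶠ e in l, c ≤ φ.comp (ContinuousLinearMap.inl ℝ E E) (e * x - x * e) +
        φ.comp (ContinuousLinearMap.inr ℝ E E) (e * z - z * e) := by
      filter_upwards [hev] with e he
      have h1 := (hc _ (subset_closure (Set.mem_image_of_mem T he))).le
      rw [hT] at h1
      rw [ContinuousLinearMap.comp_apply, ContinuousLinearMap.comp_apply, ← map_add]
      simpa using h1
    exact absurd (ge_of_tendsto ht hge) (not_le.2 hc0)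
  obtain ⟨_, ⟨y, hy, rfl⟩, hd⟩ := Metric.mem_closure_iff.1 h0 η hη
  rw [dist_comm, dist_zero_right, hT, Prod.norm_def, max_lt_iff] at hd
  exact ⟨y, hy.1.1, hy.1.2.1, hy.1.2.2, hy.2, hd.1, hd.2⟩

end ClosedIdeal
end

noncomputable section

open Filter Topology Polynomial

/-! ### Functional calculus, commutators and the pair `y`, `√(1 - y²)`. -/

section Contractions

variable {E : Type*} [CStarAlgebra E]

theorem CStarAlgebra.norm_one_le : ‖(1 : E)‖ ≤ 1 := by
  cases subsingleton_or_nontrivial E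
  · simp [Subsingleton.elim (1 : E) 0]
  · exact CStarRing.norm_one.le

theorem CStarAlgebra.norm_le_one_of_star_mul_self {u : E} (hu : star u * u = 1) : ‖u‖ ≤ 1 := by
  have h : ‖u‖ * ‖u‖ ≤ 1 := by
    rw [← CStarRing.norm_star_mul_self, hu]
    exact norm_one_le
  nlinarith [norm_nonneg u]

theorem CStarAlgebra.norm_mul_le_left {a b : E} (ha : ‖a‖ ≤ 1) : ‖a * b‖ ≤ ‖b‖ :=
  (norm_mul_le _ _).trans (mul_le_of_le_one_left (norm_nonneg _) ha)

theorem CStarAlgebra.norm_mul_le_right {a b : E} (hb : ‖b‖ ≤ 1) : ‖a * b‖ ≤ ‖a‖ :=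
  (norm_mul_le _ _).trans (mul_le_of_le_one_right (norm_nonneg _) hb)

open CStarAlgebra

/-- By the Leibniz rule the commutator with `y ^ n` costs at most a factor `n`, so `C = ∑ n |cₙ|`
works for all contractions `y` simultaneously. -/
theorem exists_norm_commutator_aeval_le (p : ℝ[X]) :
    ∃ C : ℝ, 0 ≤ C ∧ ∀ y b : E, ‖y‖ ≤ 1 →
      ‖aeval y p * b - b * aeval y p‖ ≤ C * ‖y * b - b * y‖ := by
  induction p using Polynomial.induction_on' with
  | add p q hp hq =>
    obtain ⟨C, hC0, hC⟩ := hp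
    obtain ⟨D, hD0, hD⟩ := hq
    refine ⟨C + D, add_nonneg hC0 hD0, fun y b hy => ?_⟩
    have : aeval y (p + q) * b - b * aeval y (p + q)
        = (aeval y p * b - b * aeval y p) + (aeval y q * b - b * aeval y q) := by
      rw [map_add]; noncomm_ring
    rw [this, add_mul]
    exact (norm_add_le _ _).trans (add_le_add (hC y b hy) (hD y b hy))
  | monomial n c =>
    have key (y b : E) (hy : ‖y‖ ≤ 1) : ‖y ^ n * b - b * y ^ n‖ ≤ n * ‖y * b - b * y‖ := by
      have hpow (m : ℕ) : ‖y ^ m‖ ≤ 1 := by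
        induction m with
        | zero => rw [pow_zero]; exact norm_one_le
        | succ m ih => rw [pow_succ]; exact (norm_mul_le_right hy).trans ih
      induction n with
      | zero => simp
      | succ n ih =>
        have : y ^ (n + 1) * b - b * y ^ (n + 1)
            = y * (y ^ n * b - b * y ^ n) + (y * b - b * y) * y ^ n := by
          rw [pow_succ']; noncomm_ring
        rw [this]
        refine (norm_add_le _ _).trans ?_
        push_cast
        linarith [norm_mul_le_left (b := y ^ n * b - b * y ^ n) hy,
          norm_mul_le_right (a := y * b - b * y) (hpow n)]
    refine ⟨|c| * n, by positivity, fun y b hy => ?_⟩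
    rw [aeval_monomial, ← Algebra.smul_def, smul_mul_assoc, mul_smul_comm, ← smul_sub, norm_smul,
      mul_assoc]
    exact mul_le_mul_of_nonneg_left (key y b hy) (abs_nonneg c)

theorem spectrum_subset_Icc_of_norm_le_one {y : E} (hy : ‖y‖ ≤ 1) :
    spectrum ℝ y ⊆ Set.Icc (-1) 1 := by
  intro t ht
  have h := (spectrum.norm_le_norm_mul_of_mem ht).trans
    (mul_le_one₀ hy (norm_nonneg _) norm_one_le)
  exact abs_le.1 h

/-- The functional calculus of an element that almost commutes with `b` almost commutes with
`b`. -/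
theorem exists_norm_commutator_cfc_lt {g : ℝ → ℝ} (hg : ContinuousOn g (Set.Icc (-1) 1)) {η : ℝ}
    (hη : 0 < η) : ∃ δ > 0, ∀ y b : E, IsSelfAdjoint y → ‖y‖ ≤ 1 → ‖b‖ ≤ 1 →
      ‖y * b - b * y‖ < δ → ‖cfc g y * b - b * cfc g y‖ < η := by
  -- Weierstrass: the two products of the remainder with `b` cost `η / 4` each, which leaves `η / 2`
  -- for the polynomial.
  obtain ⟨p, hp⟩ := exists_polynomial_near_of_continuousOn (-1) 1 g hg (η / 4) (by positivity)
  obtain ⟨C, hC0, hC⟩ := exists_norm_commutator_aeval_le (E := E) p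
  refine ⟨η / (2 * (C + 1)), by positivity, fun y b hys hy hb hyb => ?_⟩
  have hσ := spectrum_subset_Icc_of_norm_le_one hy
  set r := cfc g y - aeval y p with hr
  have hrn : ‖r‖ ≤ η / 4 := by
    rw [hr, ← cfc_polynomial p y hys, ← cfc_sub g _ y (hg.mono hσ) (by fun_prop)]
    refine norm_cfc_le (by positivity) fun t ht => ?_
    rw [Real.norm_eq_abs, abs_sub_comm]
    exact (hp t (hσ ht)).le
  have : cfc g y * b - b * cfc g y = (aeval y p * b - b * aeval y p) + r * b - b * r := by
    rw [hr]; noncomm_ring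
  rw [this]
  have h1 : (C + 1) * ‖y * b - b * y‖ < η / 2 := by
    rw [lt_div_iff₀ (by positivity)] at hyb
    linarith
  have h2 := hC y b hy
  have h3 := norm_mul_le_right (a := r) hb
  have h4 := norm_mul_le_left (b := r) hb
  have h6 : ‖b * r‖ ≤ ‖r‖ := norm_mul_le_left hb
  have := norm_nonneg (y * b - b * y)
  refine (norm_sub_le _ _).trans_lt ?_
  have := norm_add_le (aeval y p * b - b * aeval y p) (r * b)
  linarith

/-- `y ↦ √(1 - y²)`. -/
def cosqrt (y : E) : E := cfc (fun t : ℝ => √(1 - t ^ 2)) y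

theorem isSelfAdjoint_cosqrt (y : E) : IsSelfAdjoint (cosqrt y) := cfc_predicate _ _

theorem norm_cosqrt_le (y : E) : ‖cosqrt y‖ ≤ 1 := by
  refine norm_cfc_le zero_le_one fun t _ => ?_
  rw [Real.norm_of_nonneg (Real.sqrt_nonneg _)]
  refine Real.sqrt_le_one.2 ?_
  linarith [sq_nonneg t]

theorem cosqrt_mul_self {y : E} (hys : IsSelfAdjoint y) (hy : ‖y‖ ≤ 1) :
    cosqrt y * cosqrt y = 1 - y * y := by
  rw [cosqrt, ← cfc_mul _ _ y (by fun_prop) (by fun_prop)]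
  have h1 : 1 - y * y = cfc (fun t : ℝ => 1 - t * t) y := by
    rw [cfc_sub (fun _ : ℝ => 1) (fun t => t * t) y (by fun_prop) (by fun_prop),
      cfc_const_one ℝ y hys, cfc_mul (fun t : ℝ => t) (fun t => t) y (by fun_prop) (by fun_prop),
      cfc_id' ℝ y hys]
  rw [h1]
  refine cfc_congr fun t ht => ?_
  have := spectrum_subset_Icc_of_norm_le_one hy ht
  change √(1 - t ^ 2) * √(1 - t ^ 2) = _
  rw [Real.mul_self_sqrt (by nlinarith [this.1, this.2])]
  ring

/-- The function `√(1 - t²) - 1` vanishes at `0`, so its non-unital functional calculus does not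
leave the closed *-subalgebra `I`. -/
theorem cosqrt_sub_one_mem (I : ClosedIdeal E) {y : E} (hys : IsSelfAdjoint y) (hy : y ∈ I) :
    cosqrt y - 1 ∈ I := by
  have : IsClosed (I.toStarSubalgebra : Set E) := I.isClosed
  have h1 : cosqrt y - 1 = cfcₙ (fun t : ℝ => √(1 - t ^ 2) - 1) y := by
    rw [cfcₙ_eq_cfc (by fun_prop) (by simp), cfc_sub _ _ y (by fun_prop) (by fun_prop),
      cfc_const_one ℝ y hys, cosqrt]
  rw [h1]
  exact cfcₙ_mem (𝕜' := ℂ) (s := I.toStarSubalgebra) _ hy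

/-- `(a, b) ↦ x a x + y b y` is positive and takes `(1, 1)` to `x² + y² = 1`, so it preserves the
order bounds `-r ≤ · ≤ r`. The triangle inequality alone would lose a factor `2`. -/
theorem norm_conj_add_conj_le {x y a b : E} (hx : IsSelfAdjoint x) (hy : IsSelfAdjoint y)
    (hxy : x * x + y * y = 1) (ha : IsSelfAdjoint a) (hb : IsSelfAdjoint b) {r : ℝ} (hr : 0 < r)
    (har : ‖a‖ ≤ r) (hbr : ‖b‖ ≤ r) : ‖x * a * x + y * b * y‖ ≤ r := by
  let _ := CStarAlgebra.spectralOrder E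
  let _ := CStarAlgebra.spectralOrderedRing E
  have key {a b : E} (ha : IsSelfAdjoint a) (hb : IsSelfAdjoint b) (ha1 : ‖a‖ ≤ 1)
      (hb1 : ‖b‖ ≤ 1) : ‖x * a * x + y * b * y‖ ≤ 1 := by
    obtain ⟨ha2, ha3⟩ := (between_neg_one_one_iff a).2 ⟨ha, ha1⟩
    obtain ⟨hb2, hb3⟩ := (between_neg_one_one_iff b).2 ⟨hb, hb1⟩
    refine ((between_neg_one_one_iff _).1 ⟨?_, ?_⟩).2
    · have := add_le_add (hx.conjugate_le_conjugate ha2) (hy.conjugate_le_conjugate hb2)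
      have h1 : x * -1 * x + y * -1 * y = -1 := by
        simp only [mul_neg, mul_one, neg_mul]
        rw [← neg_add, hxy]
      rwa [h1] at this
    · have := add_le_add (hx.conjugate_le_conjugate ha3) (hy.conjugate_le_conjugate hb3)
      rwa [mul_one, mul_one, hxy] at this
  have hn {c : E} (hc : ‖c‖ ≤ r) : ‖r⁻¹ • c‖ ≤ 1 := by
    rw [norm_smul, norm_inv, Real.norm_of_nonneg hr.le]
    exact inv_mul_le_one_of_le₀ hc hr.le
  have := key ((IsSelfAdjoint.all r⁻¹).smul ha) ((IsSelfAdjoint.all r⁻¹).smul hb) (hn har) (hn hbr)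
  rw [mul_smul_comm, mul_smul_comm, smul_mul_assoc, smul_mul_assoc, ← smul_add, norm_smul,
    norm_inv, Real.norm_of_nonneg hr.le, inv_mul_le_iff₀ hr, mul_one] at this
  exact this

end Contractions
end

noncomputable section

open Filter Topology CStarAlgebra

/-! ### Perturbing `h` inside an ideal to reach the optimal commutator norm. -/

namespace ClosedIdeal

variable {E : Type*} [CStarAlgebra E] (I : ClosedIdeal E)

/-- A cut-down, by an element of `I`, of a self-adjoint element has almost the norm of its class
modulo `I`. -/
theorem exists_compression {a i : E} (hi : i ∈ I) {η : ℝ} (hη : 0 < η) :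
    ∃ f ∈ I, IsSelfAdjoint f ∧ ‖1 - f‖ ≤ 1 ∧
      ‖(1 - f) * a * (1 - f)‖ ≤ ‖a - i‖ + η := by
  obtain ⟨f, hfI, hfs, hf, hfi⟩ := exists_approx I.toStarSubalgebra I.isClosed hi hη
  have hf1 : ‖1 - f‖ ≤ 1 := by
    have := hf 1
    rw [one_mul] at this
    exact this.trans norm_one_le
  refine ⟨f, hfI, hfs, hf1, ?_⟩
  have h1 : (1 - f) * a * (1 - f) = (1 - f) * (a - i) * (1 - f) + (1 - f) * (i - i * f) := by
    noncomm_ring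
  rw [h1]
  exact (norm_add_le _ _).trans (add_le_add ((norm_mul_le_right hf1).trans (norm_mul_le_left hf1))
    ((norm_mul_le_left hf1).trans hfi.le))

/-- A perturbation inside `I` that improves the norm of `u h u* - h`. -/
theorem exists_improvement {u h : E} (hu : star u * u = 1)
    (hs : IsSelfAdjoint h) (hh : ‖h‖ ≤ 1) {ε d : ℝ} (hε : 0 < ε) (hd : 0 < d)
    (hD : ‖u * h * star u - h‖ ≤ ε * (1 + d))
    (hI : ∀ η > 0, ∃ i ∈ I, ‖u * h * star u - h - i‖ < ε + η) :
    ∃ k : E, IsSelfAdjoint k ∧ ‖k‖ ≤ 1 ∧ k - h ∈ I ∧ ‖k - h‖ ≤ 2 * d ∧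
      ‖u * k * star u - k‖ ≤ ε * (1 + d / 2) := by
  have hun : ‖u‖ ≤ 1 := norm_le_one_of_star_mul_self hu
  have hun' : ‖star u‖ ≤ 1 := by rwa [norm_star]
  set a := u * h * star u - h with ha
  have has : IsSelfAdjoint a := (hs.conjugate u).sub hs
  have ha2 : ‖a‖ ≤ 2 := by
    have h1 : ‖u * h * star u‖ ≤ 1 :=
      (norm_mul_le_right hun').trans ((norm_mul_le_left hun).trans hh)
    linarith [norm_sub_le (u * h * star u) h]
  -- The errors in `u k u* - k` add up to `10 κ ≤ ε d / 2`; those in `k - h` add up to `2 κ ≤ d`.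
  set κ := min (ε * d / 20) (d / 2) with hκ
  have hκ0 : 0 < κ := lt_min (by positivity) (by positivity)
  have hκ1 : κ ≤ ε * d / 20 := min_le_left _ _
  have hκ2 : κ ≤ d / 2 := min_le_right _ _
  obtain ⟨i, hiI, hi⟩ := hI κ hκ0
  obtain ⟨f, hfI, hfs, hf1, hfa⟩ := I.exists_compression (a := a) hiI hκ0
  have hf2 : ‖f‖ ≤ 2 := by
    have : f = 1 - (1 - f) := by abel
    rw [this]
    linarith [norm_sub_le 1 (1 - f), norm_one_le (E := E)]
  obtain ⟨δ, hδ0, hδ⟩ := exists_norm_commutator_cfc_lt (E := E)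
    (g := fun t : ℝ => √(1 - t ^ 2)) (by fun_prop) hκ0
  -- The tolerance `κ ^ 2 / 4` is for `f - y f`: `‖x f‖²` will be bounded by four times that norm.
  -- The tolerance `δ` transfers the almost commutation from `y` to `x = √(1 - y²)`.
  obtain ⟨y, hyI, hys, hy1, hyf, hyu, hyh⟩ := I.exists_quasicentral hfI u h
    (lt_min (lt_min hκ0 hδ0) (show 0 < κ ^ 2 / 4 by positivity))
  rw [lt_min_iff, lt_min_iff] at hyf hyu hyh
  set x := cosqrt y with hx
  have hxs : IsSelfAdjoint x := isSelfAdjoint_cosqrt y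
  have hx1 : ‖x‖ ≤ 1 := norm_cosqrt_le y
  have hxx : x * x = 1 - y * y := cosqrt_mul_self hys hy1
  have hxy : x * x + y * y = 1 := by rw [hxx]; abel
  have hxI : x - 1 ∈ I := cosqrt_sub_one_mem I hys hyI
  have hxu : ‖x * u - u * x‖ < κ := hδ y u hys hy1 hun hyu.1.2
  have hxh : ‖x * h - h * x‖ < κ := hδ y h hys hy1 hh hyh.1.2
  have hxf : ‖x * f‖ ≤ κ := by
    have h1 : ‖x * f‖ * ‖x * f‖ ≤ κ * κ := by
      -- Since `y` almost fixes `f`, `f (1 - y²) f = f (1 + y) (f - y f)` is small: `x` almost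
      -- annihilates `f`. Thus `x a x` is close to `x (1 - f) a (1 - f) x`.
      have h2 : star (x * f) * (x * f) = f * ((1 + y) * (f - y * f)) := by
        calc star (x * f) * (x * f) = f * (x * x) * f := by
              rw [star_mul, hxs.star_eq, hfs.star_eq]; noncomm_ring
          _ = _ := by rw [hxx]; noncomm_ring
      rw [← CStarRing.norm_star_mul_self, h2]
      have h3 : ‖1 + y‖ ≤ 2 := (norm_add_le _ _).trans (by linarith [norm_one_le (E := E)])
      calc ‖f * ((1 + y) * (f - y * f))‖ ≤ 2 * (2 * (κ ^ 2 / 4)) := by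
            refine (norm_mul_le _ _).trans (mul_le_mul hf2 ?_ (norm_nonneg _) zero_le_two)
            exact (norm_mul_le _ _).trans (mul_le_mul h3 hyf.2.le (norm_nonneg _) zero_le_two)
        _ = κ * κ := by ring
    exact abs_le_of_sq_le_sq' (by rw [sq, sq]; exact h1) hκ0.le |>.2
  have hfx : ‖f * x‖ ≤ κ := by
    rw [← norm_star, star_mul, hfs.star_eq, hxs.star_eq]
    exact hxf
  -- the compression has small norm after the cut-down by `1 - f`
  set b := (1 - f) * a * (1 - f) with hb
  have hbs : IsSelfAdjoint b := by
    have := has.conjugate (1 - f)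
    rwa [star_sub, star_one, hfs.star_eq] at this
  have hbn : ‖b‖ ≤ ε + 2 * κ := by linarith
  have hxab : ‖x * a * x - x * b * x‖ ≤ 4 * κ := by
    have h1 : x * a * x - x * b * x = (x * f) * (a * x) + x * ((1 - f) * (a * (f * x))) := by
      rw [hb]; noncomm_ring
    rw [h1]
    have h2 : ‖(x * f) * (a * x)‖ ≤ κ * 2 :=
      (norm_mul_le _ _).trans (mul_le_mul hxf ((norm_mul_le_right hx1).trans ha2)
        (norm_nonneg _) hκ0.le)
    have h3 : ‖x * ((1 - f) * (a * (f * x)))‖ ≤ 2 * κ :=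
      (norm_mul_le_left hx1).trans ((norm_mul_le_left hf1).trans
        ((norm_mul_le _ _).trans (mul_le_mul ha2 hfx (norm_nonneg _) zero_le_two)))
    linarith [norm_add_le ((x * f) * (a * x)) (x * ((1 - f) * (a * (f * x))))]
  -- Both `x` and `y` almost commute with `u`, so conjugation by `u` almost passes through the outer
  -- factors `z`.
  have hconj {z : E} (hz : IsSelfAdjoint z) (hz1 : ‖z‖ ≤ 1) (hzu : ‖z * u - u * z‖ < κ) :
      ‖u * (z * h * z) * star u - z * (u * h * star u) * z‖ ≤ 2 * κ := by
    have h1 : u * (z * h * z) * star u - z * (u * h * star u) * z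
        = -((z * u - u * z) * (h * (z * star u))) - z * (u * (h * star (z * u - u * z))) := by
      rw [star_sub, star_mul, star_mul, hz.star_eq]
      noncomm_ring
    rw [h1]
    have h2 : ‖(z * u - u * z) * (h * (z * star u))‖ ≤ κ := by
      refine (norm_mul_le_right ?_).trans hzu.le
      exact (norm_mul_le_left hh).trans ((norm_mul_le_left hz1).trans hun')
    have h3 : ‖z * (u * (h * star (z * u - u * z)))‖ ≤ κ := by
      refine (norm_mul_le_left hz1).trans ((norm_mul_le_left hun).trans
        ((norm_mul_le_left hh).trans ?_))
      rw [norm_star]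
      exact hzu.le
    have h4 := norm_sub_le (-((z * u - u * z) * (h * (z * star u))))
      (z * (u * (h * star (z * u - u * z))))
    rw [norm_neg] at h4
    linarith
  -- This scaling brings `‖a‖ ≤ ε (1 + d)` down to `‖t a‖ ≤ ε` and moves `h` by no more than `1 - t
  -- ≤ d`.
  set t : ℝ := (1 + d)⁻¹ with ht
  have ht0 : 0 < t := by positivity
  have ht1 : t ≤ 1 := inv_le_one_of_one_le₀ (by linarith)
  have htd : 1 - t ≤ d := by
    have : t * (1 + d) = 1 := inv_mul_cancel₀ (by positivity)
    nlinarith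
  have hts (z : E) : ‖t • z‖ ≤ ‖z‖ := by
    rw [norm_smul, Real.norm_of_nonneg ht0.le]
    exact mul_le_of_le_one_left (norm_nonneg z) ht1
  have hyhy : ‖y * h * y‖ ≤ 1 := (norm_mul_le_right hy1).trans ((norm_mul_le_left hy1).trans hh)
  refine ⟨x * h * x + y * (t • h) * y, ?_, ?_, ?_, ?_, ?_⟩
  · have h1 := hs.conjugate x
    have h2 := ((IsSelfAdjoint.all t).smul hs).conjugate y
    rw [hxs.star_eq] at h1
    rw [hys.star_eq] at h2
    exact h1.add h2
  · exact norm_conj_add_conj_le hxs hys hxy hs ((IsSelfAdjoint.all t).smul hs) one_pos hh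
      ((hts h).trans hh)
  · have h1 : x * h * x + y * (t • h) * y - h
        = (x - 1) * (h * x) + h * (x - 1) + y * ((t • h) * y) := by noncomm_ring
    rw [h1]
    exact I.add_mem (I.add_mem (I.mul_right _ hxI) (I.mul_left _ hxI)) (I.mul_right _ hyI)
  -- Writing `h = (x² + y²) h` leaves two small commutators and the true displacement `(1 - t) y h
  -- y`.
  · have h1 : x * h * x + y * (t • h) * y - h
        = -(x * (x * h - h * x)) - y * (y * h - h * y) - (1 - t) • (y * h * y) := by
      have h2 : h = (x * x + y * y) * h := by rw [hxy, one_mul]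
      nth_rewrite 3 [h2]
      rw [sub_smul, one_smul, mul_smul_comm, smul_mul_assoc]
      noncomm_ring
    rw [h1]
    have h2 : ‖x * (x * h - h * x)‖ ≤ κ := (norm_mul_le_left hx1).trans hxh.le
    have h3 : ‖y * (y * h - h * y)‖ ≤ κ := (norm_mul_le_left hy1).trans hyh.1.1.le
    have h4 : ‖(1 - t) • (y * h * y)‖ ≤ d := by
      rw [norm_smul, Real.norm_of_nonneg (by linarith)]
      exact (mul_le_of_le_one_right (by linarith) hyhy).trans htd
    have h5 := norm_sub_le (-(x * (x * h - h * x)) - y * (y * h - h * y)) ((1 - t) • (y * h * y))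
    have h6 := norm_sub_le (-(x * (x * h - h * x))) (y * (y * h - h * y))
    rw [norm_neg] at h6
    linarith
  · have hta : ‖t • a‖ ≤ ε + 2 * κ := by
      rw [norm_smul, Real.norm_of_nonneg ht0.le]
      have h1 : t * ‖a‖ ≤ t * (ε * (1 + d)) := mul_le_mul_of_nonneg_left hD ht0.le
      have h2 : t * (ε * (1 + d)) = ε := by rw [ht]; field_simp
      linarith
    -- The main term has norm at most `ε + 2 κ`; the three corrections contribute `4 κ`, `2 κ` and
    -- `2 κ`.
    have h1 : u * (x * h * x + y * (t • h) * y) * star u - (x * h * x + y * (t • h) * y)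
        = (x * b * x + y * (t • a) * y) + (x * a * x - x * b * x)
          + (u * (x * h * x) * star u - x * (u * h * star u) * x)
          + t • (u * (y * h * y) * star u - y * (u * h * star u) * y) := by
      simp only [ha, mul_smul_comm, smul_mul_assoc, smul_sub, mul_add, add_mul, mul_sub, sub_mul]
      abel
    rw [h1]
    refine norm_add₄_le.trans ?_
    have h2 : ‖x * b * x + y * (t • a) * y‖ ≤ ε + 2 * κ :=
      norm_conj_add_conj_le hxs hys hxy hbs ((IsSelfAdjoint.all t).smul has) (by positivity)
        hbn hta
    have h3 := hconj hxs hx1 hxu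
    have h4 := (hts _).trans (hconj hys hy1 hyu.1.1)
    nlinarith

/-- A self-adjoint contraction can be perturbed inside `I` so that `‖u h u* - h‖` becomes its
infimum over the class of `h` modulo `I`. -/
theorem exists_norm_conj_sub_le {u h : E} (hu : star u * u = 1)
    (hs : IsSelfAdjoint h) (hh : ‖h‖ ≤ 1) {ε : ℝ} (hε : 0 < ε)
    (hI : ∀ η > 0, ∃ i ∈ I, ‖u * h * star u - h - i‖ < ε + η) :
    ∃ k : E, IsSelfAdjoint k ∧ ‖k‖ ≤ 1 ∧ k - h ∈ I ∧ ‖u * k * star u - k‖ ≤ ε := by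
  have hun : ‖u‖ ≤ 1 := norm_le_one_of_star_mul_self hu
  -- With this constant `ε (1 + d 0) = ε + 2`, so the initial bound holds for every contraction `h`.
  let c : ℝ := 2 / ε
  have hc : 0 < c := by positivity
  let d (n : ℕ) : ℝ := c * (1 / 2) ^ n
  let Good (n : ℕ) (k : E) : Prop := IsSelfAdjoint k ∧ ‖k‖ ≤ 1 ∧ k - h ∈ I ∧
    ‖u * k * star u - k‖ ≤ ε * (1 + d n)
  have h0 : Good 0 h := by
    refine ⟨hs, hh, by rw [sub_self]; exact I.zero_mem, ?_⟩
    have h1 : ‖u * h * star u‖ ≤ 1 :=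
      (norm_mul_le_right (by rwa [norm_star])).trans ((norm_mul_le_left hun).trans hh)
    have h2 : ε * (1 + d 0) = ε + 2 := by simp only [d, c]; field_simp
    linarith [norm_sub_le (u * h * star u) h]
  have hstep (n : ℕ) (k : E) (hk : Good n k) : ∃ k', Good (n + 1) k' ∧ ‖k' - k‖ ≤ 2 * d n := by
    obtain ⟨hks, hk1, hkI, hkD⟩ := hk
    obtain ⟨k', h1, h2, h3, h4, h5⟩ := I.exists_improvement hu hks hk1 hε
      (show 0 < d n by positivity) hkD (fun η hη => by
        obtain ⟨i, hi, hin⟩ := hI η hη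
        -- Replacing `h` by `k` does not change the class of `u h u* - h` modulo `I`, so the
        -- hypothesis on distances survives every step of the iteration.
        refine ⟨i + (u * (k - h) * star u - (k - h)), I.add_mem hi
          (I.sub_mem (I.mul_right _ (I.mul_left _ hkI)) hkI), ?_⟩
        have : u * k * star u - k - (i + (u * (k - h) * star u - (k - h)))
            = u * h * star u - h - i := by noncomm_ring
        rwa [this])
    refine ⟨k', ⟨h1, h2, ?_, ?_⟩, h4⟩
    · have := I.add_mem h3 hkI
      rwa [sub_add_sub_cancel] at this
    · have : d (n + 1) = d n / 2 := by simp only [d, pow_succ]; ring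
      rwa [this]
  choose! next hnext hdist using hstep
  let k (n : ℕ) : E := n.rec h next
  have hk (n : ℕ) : Good n (k n) := by
    induction n with
    | zero => exact h0
    | succ n ih => exact hnext n _ ih
  have hcauchy : CauchySeq k := by
    refine cauchySeq_of_le_geometric (1 / 2) (2 * c) (by norm_num) fun n => ?_
    rw [dist_comm, dist_eq_norm, mul_assoc]
    exact hdist n _ (hk n)
  obtain ⟨l, hl⟩ := cauchySeq_tendsto_of_complete hcauchy
  refine ⟨l, ?_, ?_, ?_, ?_⟩
  · exact (isClosed_eq continuous_star continuous_id).mem_of_tendsto hl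
      (.of_forall fun n => (hk n).1)
  · exact le_of_tendsto hl.norm (.of_forall fun n => (hk n).2.1)
  · exact I.isClosed.mem_of_tendsto (hl.sub_const h) (.of_forall fun n => (hk n).2.2.1)
  · have hd : Tendsto (fun n => ε * (1 + d n)) atTop (𝓝 ε) := by
      have := (((tendsto_pow_atTop_nhds_zero_of_lt_one (r := (1 / 2 : ℝ)) (by norm_num)
        (by norm_num)).const_mul c).const_add 1).const_mul ε
      rwa [mul_zero, add_zero, mul_one] at this
    exact le_of_tendsto_of_tendsto' (((hl.const_mul u).mul_const (star u)).sub hl).norm hd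
      fun n => (hk n).2.2.2

end ClosedIdeal
end

noncomputable section

open Filter Topology CStarAlgebra
open scoped CStarAlgebra

/-! ### Lifting projections, self-adjoint contractions and unitaries. -/

section Lifting

variable {D F : Type*} [NonUnitalCStarAlgebra D] [NonUnitalCStarAlgebra F]

theorem abs_mul_self_sub_self_le {a : D} (ha : IsSelfAdjoint a) {t : ℝ}
    (ht : t ∈ quasispectrum ℝ a) : |t * t - t| ≤ ‖a * a - a‖ := by
  have h : cfcₙ (fun t : ℝ => t * t - t) a = a * a - a := by
    rw [cfcₙ_sub (fun t : ℝ => t * t) (fun t => t) a (by fun_prop) (by simp) (by fun_prop) (by simp),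
      cfcₙ_mul (fun t : ℝ => t) (fun t => t) a, cfcₙ_id' ℝ a ha]
  rw [← h]
  exact norm_apply_le_norm_cfcₙ (fun t : ℝ => t * t - t) a ht (by fun_prop) (by simp) ha

/-- Almost idempotent self-adjoint elements are close to projections, compatibly with
*-homomorphisms. -/
theorem exists_projection_of_norm_lt {d : D} (hd : IsSelfAdjoint d)
    (hn : ‖d * d - d‖ < 3 / 16) (π : D →⋆ₙₐ[ℂ] F) (hp : π d * π d = π d) :
    ∃ P : D, IsSelfAdjoint P ∧ P * P = P ∧ π P = π d := by
  -- If `|t² - t| < 3/16`, then `t < 1/4` or `t > 3/4`, where `f` is `0` or `1` respectively. The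
  -- spectrum of the projection `π d` lies in `{0, 1}`, which `f` fixes.
  let f : ℝ → ℝ := fun t => max 0 (min 1 (2 * t - 1 / 2))
  have hf : Continuous f := by fun_prop
  have hf0 : f 0 = 0 := by norm_num [f]
  refine ⟨cfcₙ f d, cfcₙ_predicate _ _, ?_, ?_⟩
  · rw [← cfcₙ_mul f f d hf.continuousOn hf0 hf.continuousOn hf0]
    refine cfcₙ_congr fun t ht => ?_
    have h1 := abs_lt.1 ((abs_mul_self_sub_self_le hd ht).trans_lt hn)
    change f t * f t = f t
    rcases le_or_gt t (1 / 2) with h | h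
    · have h2 : t < 1 / 4 := by nlinarith
      have h3 : f t = 0 := max_eq_left ((min_le_right _ _).trans (by linarith))
      rw [h3, mul_zero]
    · have h2 : 3 / 4 < t := by nlinarith
      have h3 : f t = 1 := by
        simp only [f]
        rw [min_eq_left (by linarith), max_eq_right zero_le_one]
      rw [h3, mul_one]
  · have hπd : IsSelfAdjoint (π d) := hd.map π
    rw [π.map_cfcₙ f d hf.continuousOn hf0 (map_continuous π) hd hπd]
    conv_rhs => rw [← cfcₙ_id' ℝ (π d) hπd]
    refine cfcₙ_congr fun t ht => ?_
    have h1 := abs_mul_self_sub_self_le hπd ht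
    rw [hp, sub_self, norm_zero] at h1
    have h2 : t * (t - 1) = 0 := by
      have := abs_nonpos_iff.1 h1
      linarith
    rcases mul_eq_zero.1 h2 with rfl | h
    · exact hf0
    · have : t = 1 := by linarith
      subst this
      norm_num [f]

/-- Self-adjoint contractions lift to self-adjoint contractions. -/
theorem exists_contraction_lift (π : D →⋆ₙₐ[ℂ] F) (hπ : Function.Surjective π) {b : F}
    (hb : IsSelfAdjoint b) (hb1 : ‖b‖ ≤ 1) : ∃ a : D, IsSelfAdjoint a ∧ ‖a‖ ≤ 1 ∧ π a = b := by
  obtain ⟨c, hc⟩ := hπ b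
  let d : D := (1 / 2 : ℝ) • (c + star c)
  have hd : IsSelfAdjoint d := (IsSelfAdjoint.all (1 / 2 : ℝ)).smul (IsSelfAdjoint.add_star_self c)
  have hπd : π d = b := by
    have h1 : d = ((1 / 2 : ℝ) : ℂ) • (c + star c) := (Complex.coe_smul _ _).symm
    rw [h1, map_smul, map_add, map_star, hc, hb.star_eq, ← two_smul ℂ b, smul_smul]
    norm_num
  -- Truncation to `[-1, 1]` is the identity on the spectrum of the contraction `b`, so it does not
  -- change the image.
  let f : ℝ → ℝ := fun t => max (-1) (min 1 t)
  have hf : Continuous f := by fun_prop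
  have hf0 : f 0 = 0 := by norm_num [f]
  refine ⟨cfcₙ f d, cfcₙ_predicate _ _, norm_cfcₙ_le fun t _ => ?_, ?_⟩
  · exact abs_le.2 ⟨le_max_left _ _, max_le (by norm_num) (min_le_left _ _)⟩
  · rw [π.map_cfcₙ f d hf.continuousOn hf0 (map_continuous π) hd (hd.map π), hπd]
    conv_rhs => rw [← cfcₙ_id' ℝ b hb]
    refine cfcₙ_congr fun t ht => ?_
    have h1 := norm_apply_le_norm_cfcₙ (fun t : ℝ => t) b ht (by fun_prop) (by simp) hb
    rw [cfcₙ_id' ℝ b hb] at h1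
    have h2 := abs_le.1 (h1.trans hb1)
    change max (-1) (min 1 t) = t
    rw [min_eq_right h2.2, max_eq_right h2.1]

end Lifting

/-- Almost unitary elements are close to unitaries, compatibly with *-homomorphisms. -/
theorem exists_unitary_of_norm_lt {E F : Type*} [CStarAlgebra E] [CStarAlgebra F] {w P : E}
    (h1 : ‖1 - star w * w‖ < 1) (h2 : ‖1 - w * star w‖ < 1) (hP : IsSelfAdjoint P)
    (hwP : Commute w P) (ρ : E →⋆ₐ[ℂ] F) (hρ : star (ρ w) * ρ w = 1) :
    ∃ u : E, star u * u = 1 ∧ u * star u = 1 ∧ Commute u P ∧ ρ u = ρ w := by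
  set q := star w * w with hq
  have hqs : IsSelfAdjoint q := .star_mul_self w
  obtain ⟨q', hq'⟩ : IsUnit q := by
    have := isUnit_one_sub_of_norm_lt_one h1
    rwa [sub_sub_cancel] at this
  obtain ⟨r', hr'⟩ : IsUnit (w * star w) := by
    have := isUnit_one_sub_of_norm_lt_one h2
    rwa [sub_sub_cancel] at this
  have hpos {t : ℝ} (ht : t ∈ spectrum ℝ q) : 0 < t := by
    refine (spectrum_star_mul_self_nonneg t ht).lt_of_ne ?_
    rintro rfl
    exact spectrum.zero_notMem ℝ (hq' ▸ q'.isUnit) ht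
  -- The unitary is the polar part `w (w* w)^(-1/2)`. Its second factor commutes with `P`, and `ρ`
  -- sends it to `1` because `ρ (w* w) = 1`.
  let f : ℝ → ℝ := fun t => (√t)⁻¹
  have hf : ContinuousOn f (spectrum ℝ q) :=
    Real.continuous_sqrt.continuousOn.inv₀ fun t ht => (Real.sqrt_pos.2 (hpos ht)).ne'
  set T := cfc f q with hT
  have hTs : IsSelfAdjoint T := cfc_predicate _ _
  have hTq : Commute T q := (Commute.refl q).cfc_real f
  have hTT : T * T * q = 1 := by
    have h3 : cfc (fun t : ℝ => t) q = q := cfc_id' ℝ q hqs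
    have h5 : T * T * q = cfc (fun t => f t * f t * t) q := by
      rw [cfc_mul (fun t => f t * f t) (fun t => t) q (hf.mul hf) continuousOn_id,
        cfc_mul f f q hf hf, h3]
    rw [h5, ← cfc_const_one ℝ q hqs]
    refine cfc_congr fun t ht => ?_
    have h4 := hpos ht
    change (√t)⁻¹ * (√t)⁻¹ * t = 1
    rw [← mul_inv, Real.mul_self_sqrt h4.le, inv_mul_cancel₀ h4.ne']
  have huu : star (w * T) * (w * T) = 1 := by
    rw [star_mul, hTs.star_eq]
    calc T * star w * (w * T) = T * (q * T) := by rw [hq]; noncomm_ring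
      _ = 1 := by rw [← hTq.eq, ← mul_assoc, hTT]
  -- Invertibility of `w w*` gives the isometry `w T` a right inverse, which must then be its
  -- adjoint.
  have hright : w * T * (T * q * (star w * (↑r'⁻¹ : E))) = 1 := by
    calc w * T * (T * q * (star w * (↑r'⁻¹ : E)))
        = w * (T * T * q) * (star w * (↑r'⁻¹ : E)) := by noncomm_ring
      _ = 1 := by rw [hTT, mul_one, ← mul_assoc, ← hr', r'.mul_inv]
  refine ⟨w * T, huu, ?_, ?_, ?_⟩
  · rw [left_inv_eq_right_inv huu hright, hright]
  · have hsP : Commute (star w) P := by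
      have := hwP.star_star
      rwa [hP.star_eq] at this
    exact hwP.mul_left ((hsP.mul_left hwP).cfc_real f)
  · have h3 : ρ q = 1 := by rw [hq, map_mul, map_star, hρ]
    have h4 : ρ T = 1 := by
      rw [hT, ρ.map_cfc f q hf (map_continuous ρ) hqs (hqs.map ρ), h3, cfc_apply_one]
      simp [f]
    rw [map_mul, h4, mul_one]

/-! ### Norms along an increasing sequence of ideals, and kernels. -/

namespace ClosedIdeal

variable {B : Type*} [NonUnitalCStarAlgebra B]

theorem quotientMap_surjective (I : ClosedIdeal B) : Function.Surjective I.quotientMap :=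
  Quotient.proj_surjective

theorem quotientMap_eq_zero (I : ClosedIdeal B) {b : B} : I.quotientMap b = 0 ↔ b ∈ I := by
  rw [← map_zero I.quotientMap]
  change Quotient.proj b = Quotient.proj 0 ↔ _
  rw [Quotient.proj_eq, sub_zero]

/-- The norm in the quotient by the closure of an increasing union of ideals is the limit of the
norms in the quotients. -/
theorem exists_norm_quotientMap_lt {J : ℕ → ClosedIdeal B} {K : ClosedIdeal B} (hJ : Monotone J)
    (hK : (K : Set B) = closure (⋃ n, (J n : Set B))) (b : B) {r : ℝ}
    (hr : ‖K.quotientMap b‖ < r) : ∃ N, ∀ n ≥ N, ‖(J n).quotientMap b‖ < r := by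
  set η := r - ‖K.quotientMap b‖ with hη
  have hη0 : 0 < η := sub_pos.2 hr
  -- Take a representative `a` of nearly minimal norm. The difference `b - a` lies in `K`, hence
  -- near some `j ∈ J N`, and subtracting `j` changes no class modulo `J n` for `n ≥ N`.
  obtain ⟨a, ha, han⟩ := Quotient.exists_norm_lt (K.quotientMap b) (half_pos hη0)
  have hba : b - a ∈ closure (⋃ n, (J n : Set B)) := by
    rw [← hK]
    exact Quotient.proj_eq.1 ha.symm
  obtain ⟨j, hj, hd⟩ := Metric.mem_closure_iff.1 hba (η / 2) (half_pos hη0)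
  obtain ⟨N, hN⟩ := Set.mem_iUnion.1 hj
  refine ⟨N, fun n hn => ?_⟩
  have h1 : (J n).quotientMap b = (J n).quotientMap (b - j) := by
    rw [map_sub, (quotientMap_eq_zero _).2 (hJ hn hN), sub_zero]
  rw [h1]
  refine (Quotient.norm_proj_le _).trans_lt ?_
  rw [dist_eq_norm] at hd
  have h2 : b - j = a + (b - a - j) := by abel
  rw [h2]
  linarith [norm_add_le a (b - a - j)]

/-- The kernel of a *-homomorphism. -/
def ker {D F : Type*} [NonUnitalCStarAlgebra D] [NonUnitalCStarAlgebra F] (π : D →⋆ₙₐ[ℂ] F) :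
    ClosedIdeal D where
  carrier := {x | π x = 0}
  add_mem' {a b} ha hb := by
    change π a = 0 at ha
    change π b = 0 at hb
    change π (a + b) = 0
    rw [map_add, ha, hb, add_zero]
  zero_mem' := map_zero π
  smul_mem' c x hx := by
    change π x = 0 at hx
    change π (c • x) = 0
    rw [map_smul, hx, smul_zero]
  mul_mem_left' b x hx := by
    change π x = 0 at hx
    change π (b * x) = 0
    rw [map_mul, hx, mul_zero]
  mul_mem_right' b x hx := by
    change π x = 0 at hx
    change π (x * b) = 0
    rw [map_mul, hx, zero_mul]
  isClosed' := isClosed_eq (map_continuous π) continuous_const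

end ClosedIdeal
end

noncomputable section

open Filter Topology CStarAlgebra
open scoped CStarAlgebra

/-! ### *-homomorphisms on the soft cylinder and their lifting. -/

namespace SoftCylinder

open NCStarPoly

theorem ofPoly_eq_eval (ε : ℝ) : ofPoly ε = eval ![u ε, h ε] := by
  rw [eq_eval (ofPoly ε)]
  congr 1
  funext i
  fin_cases i <;> rfl

/-- The soft cylinder is generated by `u` and `h`. -/
theorem mem_of_isClosed {ε : ℝ} (S : StarSubalgebra ℂ (SoftCylinder ε))
    (hS : IsClosed (S : Set (SoftCylinder ε))) (hu : u ε ∈ S) (hh : h ε ∈ S)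
    (a : SoftCylinder ε) : a ∈ S := by
  refine (denseRange_ofPoly ε).induction_on (p := fun a => a ∈ S) a hS fun p => ?_
  rw [ofPoly_eq_eval]
  induction p using NCStarPoly.induction_linear with
  | zero => rw [map_zero]; exact zero_mem S
  | add p q hp hq => rw [map_add]; exact add_mem hp hq
  | mon w c =>
    rw [eval_monomial]
    refine SMulMemClass.smul_mem c ?_
    induction w using FreeMonoid.inductionOn' with
    | one => rw [map_one]; exact one_mem S
    | of_mul q w ih =>
      rw [map_mul]
      refine mul_mem ?_ ih
      obtain ⟨x, t⟩ := q
      have hx : (![u ε, h ε] : Fin 2 → SoftCylinder ε) x ∈ S := by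
        fin_cases x
        · exact hu
        · exact hh
      cases t
      · simpa [evalWord] using hx
      · simpa [evalWord] using star_mem hx

theorem separableSpace (ε : ℝ) : TopologicalSpace.SeparableSpace (SoftCylinder ε) := by
  let V : Submodule ℂ (SoftCylinder ε) :=
    Submodule.span ℂ (Set.range fun w : FreeMonoid (Fin 2 × Bool) => ofPoly ε (monomial w 1))
  have hV : TopologicalSpace.IsSeparable (V : Set (SoftCylinder ε)) :=
    (Set.countable_range _).isSeparable.span
  have hsub : Set.range (ofPoly ε) ⊆ V := by
    rintro _ ⟨p, rfl⟩
    induction p using NCStarPoly.induction_linear with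
    | zero => rw [map_zero]; exact V.zero_mem
    | add p q hp hq => rw [map_add]; exact V.add_mem hp hq
    | mon w c =>
      have : (monomial w c : NCStarPoly (Fin 2)) = c • monomial w 1 := by
        rw [smul_monomial, mul_one]
      rw [this, map_smul]
      exact V.smul_mem c (Submodule.subset_span ⟨w, rfl⟩)
  rw [← TopologicalSpace.isSeparable_univ_iff, ← (denseRange_ofPoly ε).closure_range]
  exact (hV.mono hsub).closure

/-- *-homomorphisms on the soft cylinder that agree at `1`, `u` and `h` are equal. -/
theorem hom_ext {ε : ℝ} {F : Type*} [NonUnitalCStarAlgebra F] {φ ψ : SoftCylinder ε →⋆ₙₐ[ℂ] F}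
    (h1 : φ 1 = ψ 1) (hu : φ (u ε) = ψ (u ε)) (hh : φ (h ε) = ψ (h ε)) : φ = ψ := by
  let S : StarSubalgebra ℂ (SoftCylinder ε) :=
    { carrier := {a | φ a = ψ a}
      mul_mem' := fun {a b} (ha : φ a = ψ a) (hb : φ b = ψ b) =>
        show φ (a * b) = ψ (a * b) by rw [map_mul, map_mul, ha, hb]
      add_mem' := fun {a b} (ha : φ a = ψ a) (hb : φ b = ψ b) =>
        show φ (a + b) = ψ (a + b) by rw [map_add, map_add, ha, hb]
      algebraMap_mem' := fun c => by
        change φ _ = ψ _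
        rw [Algebra.algebraMap_eq_smul_one, map_smul, map_smul, h1]
      star_mem' := fun {a} (ha : φ a = ψ a) =>
        show φ (star a) = ψ (star a) by rw [map_star, map_star, ha] }
  ext a
  exact mem_of_isClosed S (isClosed_eq (map_continuous φ) (map_continuous ψ)) hu hh a

/-- An element that commutes with the images of the generators commutes with all images. -/
theorem commute_map {ε : ℝ} {E : Type*} [CStarAlgebra E] (Ψ : SoftCylinder ε →⋆ₐ[ℂ] E) {P : E}
    (hP : IsSelfAdjoint P) (hu : Commute (Ψ (u ε)) P) (hh : Commute (Ψ (h ε)) P)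
    (a : SoftCylinder ε) : Commute (Ψ a) P := by
  let S : StarSubalgebra ℂ (SoftCylinder ε) :=
    { carrier := {a | Commute (Ψ a) P}
      mul_mem' := fun {a b} (ha : Commute (Ψ a) P) (hb : Commute (Ψ b) P) =>
        show Commute (Ψ (a * b)) P by rw [map_mul]; exact ha.mul_left hb
      add_mem' := fun {a b} (ha : Commute (Ψ a) P) (hb : Commute (Ψ b) P) =>
        show Commute (Ψ (a + b)) P by rw [map_add]; exact ha.add_left hb
      algebraMap_mem' := fun c => by
        change Commute (Ψ _) P
        rw [AlgHomClass.commutes]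
        exact Algebra.commutes c P
      star_mem' := fun {a} (ha : Commute (Ψ a) P) =>
        show Commute (Ψ (star a)) P by
          have := ha.star_star
          rwa [hP.star_eq, ← map_star] at this }
  refine mem_of_isClosed S ?_ hu hh a
  exact isClosed_eq ((map_continuous Ψ).mul_const P) ((map_continuous Ψ).const_mul P)

/-- Adding `1 - p` makes elements of the corner of `p` into elements of the whole ring, compatibly
with products and with `p` becoming `1`. Unitarity in a corner thereby becomes unitarity in a unital
algebra. -/
theorem add_one_sub_mul_add_one_sub {R : Type*} [Ring R] {a b p : R} (hp : p * p = p)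
    (ha : a * p = a) (hb : p * b = b) : (a + (1 - p)) * (b + (1 - p)) = a * b + (1 - p) := by
  simp only [mul_add, add_mul, mul_sub, sub_mul, mul_one, one_mul, hp, ha, hb]
  abel

/-- A *-homomorphism from the soft cylinder to a quotient lifts, once the image of the unit lifts
to a projection and the image of `u` lifts to an almost unitary of its corner. -/
theorem exists_lift_of_almost_unitary {ε : ℝ} (hε : 0 < ε) {D F : Type*}
    [NonUnitalCStarAlgebra D] [NonUnitalCStarAlgebra F] (π : D →⋆ₙₐ[ℂ] F)
    (hπ : ∀ x : F, ∀ η > 0, ∃ d : D, π d = x ∧ ‖d‖ < ‖x‖ + η) (φ : SoftCylinder ε →⋆ₙₐ[ℂ] F)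
    {P v : D} (hP : IsSelfAdjoint P) (hPP : P * P = P) (hπP : π P = φ 1) (hPv : P * v = v)
    (hvP : v * P = v) (hπv : π v = φ (u ε)) (hv1 : ‖P - star v * v‖ < 1)
    (hv2 : ‖P - v * star v‖ < 1) :
    ∃ ψ : SoftCylinder ε →⋆ₙₐ[ℂ] D, π.comp ψ = φ := by
  obtain ⟨hu1, hu2, hs, hh1, hcomm⟩ := softCylinderRel_iff.1 (rel hε.le)
  -- Neither algebra need be unital and `φ` need not preserve a unit, so the construction takes
  -- place in the unitizations and is cut down to the corner of `P` at the end.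
  let ι (d : D) : Unitization ℂ D := (d : Unitization ℂ D)
  have hι : Function.Injective ι := Unitization.inr_injective
  have ιmul (a b : D) : ι (a * b) = ι a * ι b := Unitization.inr_mul ℂ a b
  have ιstar (a : D) : ι (star a) = star (ι a) := Unitization.inr_star a
  have ιnorm (a : D) : ‖ι a‖ = ‖a‖ := Unitization.norm_inr a
  let κ (d : F) : Unitization ℂ F := (d : Unitization ℂ F)
  have hκ : Function.Injective κ := Unitization.inr_injective
  have κmul (a b : F) : κ (a * b) = κ a * κ b := Unitization.inr_mul ℂ a b
  have κstar (a : F) : κ (star a) = star (κ a) := Unitization.inr_star a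
  have κnorm (a : F) : ‖κ a‖ = ‖a‖ := Unitization.norm_inr a
  let ρ : Unitization ℂ D →⋆ₐ[ℂ] Unitization ℂ F := Unitization.starMap π
  have hρ (d : D) : ρ (ι d) = κ (π d) := Unitization.starMap_inr π d
  have hfst {x : Unitization ℂ D} (hx : x.fst = 0) : ι x.snd = x := by
    ext
    · exact hx.symm
    · rfl
  -- the unit of the corner
  set p := ι P with hp
  have hps : IsSelfAdjoint p := by
    change star p = p
    rw [hp, ← ιstar, hP.star_eq]
  have hpp : p * p = p := by rw [hp, ← ιmul, hPP]
  have hp1 : ‖p‖ ≤ 1 := by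
    have h1 : ‖p‖ * ‖p‖ = ‖p‖ := by rw [← CStarRing.norm_star_mul_self, hps.star_eq, hpp]
    nlinarith [norm_nonneg p]
  have hρp : ρ p = κ (φ 1) := by rw [hρ, hπP]
  have hκ1 (a : SoftCylinder ε) : κ (φ 1) * κ (φ a) = κ (φ a) := by
    rw [← κmul, ← map_mul, one_mul]
  have hκ2 (a : SoftCylinder ε) : κ (φ a) * κ (φ 1) = κ (φ a) := by
    rw [← κmul, ← map_mul, mul_one]
  -- the unitary
  set w := ι v + (1 - p) with hw
  have hws : star w = ι (star v) + (1 - p) := by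
    rw [hw, star_add, star_sub, star_one, hps.star_eq, ιstar]
  have hpv : p * ι v = ι v := by rw [hp, ← ιmul, hPv]
  have hvp : ι v * p = ι v := by rw [hp, ← ιmul, hvP]
  have hpv' : p * ι (star v) = ι (star v) := by
    rw [hp, ← ιmul, ← hP.star_eq, ← star_mul, hvP]
  have hvp' : ι (star v) * p = ι (star v) := by
    rw [hp, ← ιmul, ← hP.star_eq, ← star_mul, hPv]
  have hsub (a b : D) : ι (a - b) = ι a - ι b := Unitization.inr_sub ℂ a b
  have hw1 : ‖1 - star w * w‖ < 1 := by
    have h1 : 1 - star w * w = ι (P - star v * v) := by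
      rw [hws, hw, add_one_sub_mul_add_one_sub hpp hvp' hpv, hsub, ιmul]
      abel
    rwa [h1, ιnorm]
  have hw2 : ‖1 - w * star w‖ < 1 := by
    have h1 : 1 - w * star w = ι (P - v * star v) := by
      rw [hws, hw, add_one_sub_mul_add_one_sub hpp hvp hpv', hsub, ιmul]
      abel
    rwa [h1, ιnorm]
  have hwp : Commute w p := by
    change w * p = p * w
    rw [hw, add_mul, mul_add, sub_mul, mul_sub, hpv, hvp, one_mul, mul_one]
  have hρw : ρ w = κ (φ (u ε)) + (1 - κ (φ 1)) := by
    rw [hw, map_add, map_sub, map_one, hρ, hρp, hπv]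
  have hκ11 := hκ1 1
  have hκs : star (κ (φ 1)) = κ (φ 1) := by rw [← κstar, ← map_star, star_one]
  have hρws : star (ρ w) = κ (φ (star (u ε))) + (1 - κ (φ 1)) := by
    rw [hρw, star_add, star_sub, star_one, hκs, map_star, κstar]
  have hρww : star (ρ w) * ρ w = 1 := by
    rw [hρws, hρw, add_one_sub_mul_add_one_sub hκ11 (hκ2 _) (hκ1 _), ← κmul, ← map_mul, hu1]
    abel
  obtain ⟨U, hU1, hU2, hUp, hρU⟩ := exists_unitary_of_norm_lt hw1 hw2 hps hwp ρ hρww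
  -- the self-adjoint element
  have hsurj : Function.Surjective π := fun x => (hπ x 1 one_pos).imp fun d hd => hd.1
  obtain ⟨h0, h0s, h01, hπh⟩ := exists_contraction_lift π hsurj (b := φ (h ε))
    (show star (φ (h ε)) = φ (h ε) by rw [← map_star, hs])
    ((NonUnitalStarAlgHom.norm_apply_le φ _).trans hh1)
  set H := p * ι h0 * p with hH
  have hHs : IsSelfAdjoint H := by
    have h1 : IsSelfAdjoint (ι h0) := by
      change star (ι h0) = ι h0
      rw [← ιstar, h0s.star_eq]
    have := h1.conjugate p
    rwa [hps.star_eq] at this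
  have hH1 : ‖H‖ ≤ 1 := by
    refine (norm_mul_le_right hp1).trans ((norm_mul_le_left hp1).trans ?_)
    rwa [ιnorm]
  have hρH : ρ H = κ (φ (h ε)) := by
    rw [hH, map_mul, map_mul, hρp, hρ, hπh, hκ1, hκ2]
  set a := U * H * star U - H with ha
  -- `H` has no scalar part, so `a` lies in `D`, where the assumption on norms of lifts along `π`
  -- applies.
  have haι : ι a.snd = a := by
    apply hfst
    change (U * H * star U).fst - H.fst = 0
    simp [hH, hp, ι]
  have hρa : ρ a = κ (φ (u ε * h ε * star (u ε) - h ε)) := by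
    have h1 : ρ w * κ (φ (h ε)) = κ (φ (u ε * h ε)) := by
      rw [hρw, add_mul, sub_mul, one_mul, hκ1, sub_self, add_zero, map_mul, κmul]
    have h2 : κ (φ (u ε * h ε)) * star (ρ w) = κ (φ (u ε * h ε * star (u ε))) := by
      rw [hρws, mul_add, mul_sub, mul_one, hκ2, sub_self, add_zero, map_mul φ _ (star (u ε)), κmul]
    rw [ha, map_sub, map_mul, map_mul, map_star, hρU, hρH, h1, h2, map_sub]
    exact (Unitization.inr_sub ℂ _ _).symm
  have hπa : ‖π a.snd‖ ≤ ε := by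
    rw [← κnorm, ← hρ, haι, hρa, κnorm]
    refine (NonUnitalStarAlgHom.norm_apply_le φ _).trans ?_
    have h1 : u ε * h ε * star (u ε) - h ε = (u ε * h ε - h ε * u ε) * star (u ε) := by
      rw [sub_mul, mul_assoc (h ε), hu2, mul_one]
    rw [h1]
    refine (norm_mul_le_right ?_).trans hcomm
    rw [norm_star]
    exact norm_le_one_of_star_mul_self hu1
  obtain ⟨k, hks, hk1, hkI, hkD⟩ :=
    (ClosedIdeal.ker (ρ : Unitization ℂ D →⋆ₙₐ[ℂ] Unitization ℂ F)).exists_norm_conj_sub_le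
      hU1 hHs hH1 hε (fun η hη => by
        -- A nearly norm-preserving lift `d` of the image of `a` exhibits `a - d` as an element of
        -- the kernel at distance less than `ε + η` from `a`.
        obtain ⟨d, hd, hdn⟩ := hπ (π a.snd) η hη
        refine ⟨a - ι d, ?_, ?_⟩
        · change ρ (a - ι d) = 0
          rw [map_sub, hρ, hd, ← hρ, haι, sub_self]
        · rw [← ha, sub_sub_cancel, ιnorm]
          linarith)
  have hρk : ρ k = κ (φ (h ε)) := by
    have h1 : ρ (k - H) = 0 := hkI
    rwa [map_sub, hρH, sub_eq_zero] at h1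
  -- The perturbation may have left the corner. Compression by `p` returns to it without increasing
  -- the commutator norm, because `U` commutes with `p`.
  have hrel : SoftCylinderRel ε U (p * k * p) := by
    refine softCylinderRel_iff.2 ⟨hU1, hU2, ?_, ?_, ?_⟩
    · have := hks.conjugate p
      rwa [hps.star_eq] at this
    · exact (norm_mul_le_right hp1).trans ((norm_mul_le_left hp1).trans hk1)
    · have h1 : U * (p * k * p) - p * k * p * U = p * ((U * k * star U - k) * U) * p := by
        calc U * (p * k * p) - p * k * p * U = (U * p) * k * p - p * k * (p * U) := by
              noncomm_ring
          _ = (p * U) * k * p - p * k * (U * p) := by rw [hUp.eq]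
          _ = p * (U * k - k * U) * p := by noncomm_ring
          _ = _ := by rw [sub_mul, mul_assoc (U * k), hU1, mul_one]
      rw [h1]
      exact (norm_mul_le_right hp1).trans ((norm_mul_le_left hp1).trans
        ((norm_mul_le_right (norm_le_one_of_star_mul_self hU1)).trans hkD))
  obtain ⟨Ψ, ⟨hΨu, hΨh⟩, -⟩ := existsUnique_hom hrel
  have hΨp := commute_map Ψ hps (by rw [hΨu]; exact hUp) (by
    rw [hΨh]
    change p * k * p * p = p * (p * k * p)
    rw [mul_assoc, hpp, mul_assoc p k p, ← mul_assoc p p, hpp])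
  have hψ (x : SoftCylinder ε) : ι (p * Ψ x).snd = p * Ψ x := by
    apply hfst
    simp [hp, ι]
  -- The projection `p` commutes with the range of `Ψ`, so cutting by it is multiplicative; it also
  -- removes the scalar part and sends the unit to `P`.
  let ψ : SoftCylinder ε →⋆ₙₐ[ℂ] D :=
    { toFun := fun x => (p * Ψ x).snd
      map_smul' := fun c x => by
        rw [map_smul, mul_smul_comm, Unitization.snd_smul]; rfl
      map_zero' := by rw [map_zero, mul_zero, Unitization.snd_zero]
      map_add' := fun x y => by rw [map_add, mul_add, Unitization.snd_add]
      map_mul' := fun x y => hι <| by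
        rw [ιmul, hψ, hψ, hψ, map_mul]
        calc p * (Ψ x * Ψ y) = p * p * (Ψ x * Ψ y) := by rw [hpp]
          _ = p * (p * Ψ x) * Ψ y := by noncomm_ring
          _ = p * (Ψ x * p) * Ψ y := by rw [(hΨp x).eq]
          _ = _ := by noncomm_ring
      map_star' := fun x => hι <| by
        rw [ιstar, hψ, hψ, map_star, star_mul, hps.star_eq, ← map_star, (hΨp (star x)).eq] }
  have hπψ (x : SoftCylinder ε) : κ (π (ψ x)) = κ (φ 1) * ρ (Ψ x) := by
    rw [← hρ, ← hρp, ← map_mul]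
    exact congrArg ρ (hψ x)
  refine ⟨ψ, hom_ext (hκ ?_) (hκ ?_) (hκ ?_)⟩
  · rw [NonUnitalStarAlgHom.comp_apply, hπψ, map_one Ψ, map_one ρ, mul_one]
  · rw [NonUnitalStarAlgHom.comp_apply, hπψ, hΨu, hρU, hρw, mul_add, mul_sub, mul_one, hκ1, hκ1,
      sub_self, add_zero]
  · rw [NonUnitalStarAlgHom.comp_apply, hπψ, hΨh, map_mul, map_mul, hρp, hρk, hκ1, hκ2, hκ1]

end SoftCylinder

end

/-! ### Semiprojectivity. -/

open CStarAlgebra in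
theorem theorem6p1 (ε : ℝ) (hε : 0 < ε) : IsSemiprojective.{0, v} (SoftCylinder ε) := by
  refine ⟨SoftCylinder.separableSpace ε, fun B _ J K hJ hK hJK φ => ?_⟩
  obtain ⟨hu1, hu2, -⟩ := softCylinderRel_iff.1 (SoftCylinder.rel hε.le)
  have hone : φ 1 * φ 1 = φ 1 := by rw [← map_mul, one_mul]
  -- lift the image of the unit to a projection
  obtain ⟨b, hb, -, hφb⟩ : ∃ b : B, IsSelfAdjoint b ∧ ‖b‖ ≤ 1 ∧ K.quotientMap b = φ 1 :=
    exists_contraction_lift K.quotientMap K.quotientMap_surjective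
      (show star (φ 1) = φ 1 by rw [← map_star, star_one])
      ((NonUnitalStarAlgHom.norm_apply_le φ 1).trans norm_one_le)
  obtain ⟨n, hn⟩ := ClosedIdeal.exists_norm_quotientMap_lt hJ hK (b * b - b) (r := 3 / 16)
    (by rw [map_sub, map_mul, hφb, hone, sub_self, norm_zero]; norm_num)
  have hbn := hn n le_rfl
  rw [map_sub, map_mul] at hbn
  obtain ⟨P, hP, hPP, hπP⟩ := exists_projection_of_norm_lt (hb.map (J n).quotientMap) hbn
    (ClosedIdeal.factor (hJK n)) (by rw [ClosedIdeal.factor_quotientMap, hφb, hone])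
  rw [ClosedIdeal.factor_quotientMap, hφb] at hπP
  -- A representative in `B` is kept because the stage must increase once more; the class of `c`
  -- remains a projection modulo every later `J m`.
  obtain ⟨c, rfl⟩ := (J n).quotientMap_surjective P
  rw [ClosedIdeal.factor_quotientMap] at hπP
  -- lift the image of `u`
  obtain ⟨v₀, hv₀⟩ := K.quotientMap_surjective (φ (SoftCylinder.u ε))
  -- Cutting by `c` puts the class of `v` in the corner modulo `J m`, and costs nothing modulo `K`,
  -- where `c` represents `φ 1`.
  set v := c * v₀ * c with hv
  have hφv : K.quotientMap v = φ (SoftCylinder.u ε) := by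
    rw [hv, map_mul, map_mul, hπP, hv₀, ← map_mul, ← map_mul, one_mul, mul_one]
  obtain ⟨m₁, hm₁⟩ := ClosedIdeal.exists_norm_quotientMap_lt hJ hK (c - star v * v) (r := 1)
    (by rw [map_sub, map_mul, map_star, hφv, hπP, ← map_star, ← map_mul, hu1, sub_self,
      norm_zero]; norm_num)
  obtain ⟨m₂, hm₂⟩ := ClosedIdeal.exists_norm_quotientMap_lt hJ hK (c - v * star v) (r := 1)
    (by rw [map_sub, map_mul, map_star, hφv, hπP, ← map_star, ← map_mul, hu2, sub_self,
      norm_zero]; norm_num)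
  let m := max n (max m₁ m₂)
  have hnm : n ≤ m := le_max_left _ _
  have h1 := hm₁ m ((le_max_left _ _).trans (le_max_right _ _))
  have h2 := hm₂ m ((le_max_right _ _).trans (le_max_right _ _))
  rw [map_sub, map_mul, map_star] at h1 h2
  have hPm : IsSelfAdjoint ((J m).quotientMap c) := hP.map (ClosedIdeal.factor (hJ hnm))
  have hPPm : (J m).quotientMap c * (J m).quotientMap c = (J m).quotientMap c := by
    have := congrArg (ClosedIdeal.factor (hJ hnm)) hPP
    rwa [map_mul] at this
  refine ⟨m, SoftCylinder.exists_lift_of_almost_unitary hε _ ?_ φ hPm hPPm hπP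
    (v := (J m).quotientMap v) ?_ ?_ hφv h1 h2⟩
  · intro x η hη
    obtain ⟨d, hd, hdn⟩ := ClosedIdeal.Quotient.exists_norm_lt x hη
    exact ⟨(J m).quotientMap d, hd, (ClosedIdeal.Quotient.norm_proj_le d).trans_lt hdn⟩
  · rw [hv, map_mul, map_mul, ← mul_assoc, ← mul_assoc, hPPm]
  · rw [hv, map_mul, map_mul, mul_assoc, hPPm]
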